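/- Let $n\ge 0$ and $k\ge 1$ be integers and let $m_1,\dots,m_k\ge 2$ be integers such that neither ($n=0$ and $k=1$) nor ($n=0$, $k=2$ and $m_1=m_2=2$) holds. Let $G=F_{2n}*\mathbb{Z}_{m_1}*\cdots*\mathbb{Z}_{m_k}$, where $F_{2n}$ is the free group of rank $2n$ and $\mathbb{Z}_{m}=\mathbb{Z}/m\mathbb{Z}$, and let $$\widehat G=\langle e_1,\dots,e_k,h_1,\dots,h_{2n},z \mid e_1^{m_1}=\cdots=e_k^{m_k}=z,\ [h_1,z]=\cdots=[h_{2n},z]=1\rangle .$$ Then $\widehat G$ is a central extension of $G$ by $\mathbb{Z}$: the element $z$ is central and of infinite order, and there is a surjective homomorphism $\widehat G\to G$ with kernel $\langle z\rangle$. Moreover $\widehat G$ admits a countably infinite family of isolated left orders, no one of which is an automorphic image of another. Here a left order on a group $\Gamma$ is a strict total order $<$ such that $g_1<g_2$ implies $gg_1<gg_2$ for all $g,g_1,g_2\in\Gamma$. The set $LO(\Gamma)$ of left orders is topologized as a subspace of $\{\pm1\}^{\Gamma\setminus\{1\}}$ with the product topology, where $<$ corresponds to the function with value $+1$ at $g$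 if and only if $1<g$. A left order is isolated if it is an isolated point of $LO(\Gamma)$. For an automorphism $\phi$ of $\Gamma$, the automorphic image $<_\phi$ of $<$ is defined by $g_1<_\phi g_2$ if and only if $\phi(g_1)<\phi(g_2)$. -/

import Mathlib

/-- A left order on a group `Γ`: a strict total order invariant under left multiplication. -/
structure LeftOrder (Γ : Type*) [Group Γ] where
  lt : Γ → Γ → Prop
  strictTotal : IsStrictTotalOrder Γ lt
  mul_left : ∀ g g₁ g₂ : Γ, lt g₁ g₂ → lt (g * g₁) (g * g₂)

namespace LeftOrder

variable {Γ : Type*} [Group Γ]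

open Classical in
/-- The sign function of a left order on the nontrivial elements of the group: the value is
`true` (standing for `+1`) if `1 < g`, and `false` (standing for `-1`) otherwise. -/
noncomputable def sign (L : LeftOrder Γ) : {g : Γ // g ≠ 1} → Bool :=
  fun g => decide (L.lt 1 g.1)

/-- The space of left orders carries the topology of a subspace of `{±1} ^ (Γ ∖ {1})`
with the product topology, via the sign function. -/
noncomputable instance : TopologicalSpace (LeftOrder Γ) :=
  TopologicalSpace.induced sign inferInstance

/-- A left order is isolated if it is an isolated point of the space of left orders. -/
def IsIsolated (L : LeftOrder Γ) : Prop :=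
  IsOpen ({L} : Set (LeftOrder Γ))

/-- The automorphic image `<_φ` of a left order `<`: `g₁ <_φ g₂` iff `φ g₁ < φ g₂`. -/
def autImage (L : LeftOrder Γ) (φ : Γ ≃* Γ) : LeftOrder Γ where
  lt g₁ g₂ := L.lt (φ g₁) (φ g₂)
  strictTotal :=
    { trichotomous := fun a b h₁ h₂ => φ.injective (L.strictTotal.trichotomous _ _ h₁ h₂)
      irrefl := fun a => L.strictTotal.irrefl (φ a)
      trans := fun a b c => L.strictTotal.trans (φ a) (φ b) (φ c) }
  mul_left g g₁ g₂ h := by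
    rw [map_mul, map_mul]
    exact L.mul_left _ _ _ h

end LeftOrder

/-- The free product `F_{2n} * ℤ/m₁ * ⋯ * ℤ/m_k`. -/
abbrev FreeProdCyclic (n k : ℕ) (m : Fin k → ℕ) : Type :=
  Monoid.Coprod (FreeGroup (Fin (2 * n)))
    (Monoid.CoprodI fun i : Fin k => Multiplicative (ZMod (m i)))

namespace ExtGroup

/-- The generators `e₁, …, e_k`, `h₁, …, h_{2n}`, `z`. -/
inductive Gen (n k : ℕ) : Type
  | e : Fin k → Gen n k
  | h : Fin (2 * n) → Gen n k
  | z : Gen n k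

/-- The relators `eᵢ ^ mᵢ * z⁻¹` and `[hⱼ, z] = hⱼ * z * hⱼ⁻¹ * z⁻¹`. -/
def rels (n k : ℕ) (m : Fin k → ℕ) : Set (FreeGroup (Gen n k)) :=
  Set.range (fun i : Fin k =>
      FreeGroup.of (Gen.e i) ^ m i * (FreeGroup.of (Gen.z : Gen n k))⁻¹) ∪
    Set.range (fun j : Fin (2 * n) =>
      FreeGroup.of (Gen.h j : Gen n k) * FreeGroup.of (Gen.z : Gen n k) *
        (FreeGroup.of (Gen.h j : Gen n k))⁻¹ * (FreeGroup.of (Gen.z : Gen n k))⁻¹)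

end ExtGroup

/-- The group
`⟨e₁, …, e_k, h₁, …, h_{2n}, z ∣ e₁ ^ m₁ = ⋯ = e_k ^ m_k = z, [h₁, z] = ⋯ = [h_{2n}, z] = 1⟩`. -/
abbrev ExtGroup (n k : ℕ) (m : Fin k → ℕ) : Type :=
  PresentedGroup (ExtGroup.rels n k m)

/-- The element `z` of the group. -/
def ExtGroup.zElt (n k : ℕ) (m : Fin k → ℕ) : ExtGroup n k m :=
  PresentedGroup.of ExtGroup.Gen.z

/-! `G` is the orbifold fundamental group of a surface of genus `n` with `k` cone points of orders
`mᵢ` and one boundary component; the excluded cases are exactly those of nonnegative Euler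
characteristic. It acts on the circle by ping-pong: the circle is cut into `k + 4n` blocks and one
gap, powers of `eᵢ` map the complement of their block into it, and each pair of `hⱼ` uses four
interlaced blocks. Lifting to the line, with `z` acting as `x ↦ x + 1`, gives `lineHom`. The right
end `0` of a gap has a free orbit (`eq_one_of_move_zero`), which orders `Ĝ`. The boundary element
`cuspElt` pushes `0` across the gap to the left.

Infinitely many orders come from cyclic coverings of the circle. If `D ≡ 1` modulo every `mᵢ`, there
is an endomorphism `Cover.hom` over the identity of `G` with `z ↦ z ^ D`; composing it with the
action lifts the action to the `D`-fold cover, and the orbit of `0` again gives an order,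
`Cover.order`. When `D` is prime to the degrees of `z` and `cuspElt`, the image of `hom` contains
every element whose degree is divisible by `D`. Each block end, corrected by a unique power `cuspElt
^ j` with `0 ≤ j < D`, then comes from a group element `Cover.cut`, and all gaps but one modulo `D`
close up.

Isolation: any left order satisfying a few inequalities between translates of these cuts lets
ping-pong run on the group itself, and this fixes the sign of every normal form (`Rigid.sign`,
`Rigid.eq`). Multiplication by `z` shifts the inequalities by `D`, so finitely many suffice, and
they define an open set.

Inequivalence: the order of a covering has a largest negative element, which `hom` sends to `cuspElt
^ D`. An automorphism between two such orders matches these elements and preserves the center `⟨z⟩`.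
Comparing degrees and translation numbers, the latter having bounded denominators, gives `D ∣ D'`
(`dvd_of_order_eq_autImage`), hence `D = D'` by symmetry. -/

namespace ExtGroup

/-! ### The presentation and the central extension -/

variable {n k : ℕ} {m : Fin k → ℕ}

/-- The generator `eᵢ`. -/
def eElt (n : ℕ) (m : Fin k → ℕ) (i : Fin k) : ExtGroup n k m := PresentedGroup.of (Gen.e i)

/-- The generator `hⱼ`. -/
def hElt (m : Fin k → ℕ) (j : Fin (2 * n)) : ExtGroup n k m := PresentedGroup.of (Gen.h j)

theorem eElt_pow (i : Fin k) : eElt n m i ^ m i = zElt n k m := by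
  have h : PresentedGroup.mk (rels n k m)
      (FreeGroup.of (Gen.e i) ^ m i * (FreeGroup.of (Gen.z : Gen n k))⁻¹) = 1 :=
    (QuotientGroup.eq_one_iff _).2 (Subgroup.subset_normalClosure (Or.inl ⟨i, rfl⟩))
  rw [map_mul, map_inv, map_pow, mul_inv_eq_one] at h
  exact h

theorem hElt_commute (j : Fin (2 * n)) : Commute (hElt m j) (zElt n k m) := by
  have h : PresentedGroup.mk (rels n k m)
      (FreeGroup.of (Gen.h j : Gen n k) * FreeGroup.of (Gen.z : Gen n k) *
        (FreeGroup.of (Gen.h j : Gen n k))⁻¹ * (FreeGroup.of (Gen.z : Gen n k))⁻¹) = 1 :=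
    (QuotientGroup.eq_one_iff _).2 (Subgroup.subset_normalClosure (Or.inr ⟨j, rfl⟩))
  rw [map_mul, map_inv, mul_inv_eq_one, map_mul, map_inv, mul_inv_eq_iff_eq_mul, map_mul] at h
  exact h

/-- A subgroup containing the generators is everything. -/
theorem mem_of_generators (S : Subgroup (ExtGroup n k m)) (he : ∀ i, eElt n m i ∈ S)
    (hh : ∀ j, hElt m j ∈ S) (hz : zElt n k m ∈ S) (g : ExtGroup n k m) : g ∈ S := by
  refine PresentedGroup.generated_by _ S (fun x => ?_) g
  cases x with
  | e i => exact he i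
  | h j => exact hh j
  | z => exact hz

theorem zElt_commute (g : ExtGroup n k m) : Commute (zElt n k m) g := by
  have h := mem_of_generators (Subgroup.centralizer {zElt n k m})
    (fun i => Subgroup.mem_centralizer_singleton_iff.2 (by
      rw [← eElt_pow i]; exact (Commute.refl _).pow_right _))
    (fun j => Subgroup.mem_centralizer_singleton_iff.2 (hElt_commute j))
    (Subgroup.mem_centralizer_singleton_iff.2 rfl) g
  exact (Subgroup.mem_centralizer_singleton_iff.1 h).symm

theorem zElt_zpow_commute (s : ℤ) (g : ExtGroup n k m) : Commute (zElt n k m ^ s) g :=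
  (zElt_commute g).zpow_left s

/-- The universal property of the presentation. -/
def lift {Q : Type*} [Group Q] (E : Fin k → Q) (H : Fin (2 * n) → Q) (Z : Q)
    (hE : ∀ i, E i ^ m i = Z) (hH : ∀ j, Commute (H j) Z) : ExtGroup n k m →* Q :=
  PresentedGroup.toGroup (f := fun x => match x with
    | .e i => E i
    | .h j => H j
    | .z => Z) (by
      rintro r (⟨i, rfl⟩ | ⟨j, rfl⟩)
      · simp [hE]
      · simp [(hH j).eq])

section lift

variable {Q : Type*} [Group Q] {E : Fin k → Q} {H : Fin (2 * n) → Q} {Z : Q}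
  {hE : ∀ i, E i ^ m i = Z} {hH : ∀ j, Commute (H j) Z}

@[simp]
theorem lift_eElt (i : Fin k) : lift E H Z hE hH (eElt n m i) = E i :=
  PresentedGroup.toGroup.of _

@[simp]
theorem lift_hElt (j : Fin (2 * n)) : lift E H Z hE hH (hElt m j) = H j :=
  PresentedGroup.toGroup.of _

@[simp]
theorem lift_zElt : lift E H Z hE hH (zElt n k m) = Z :=
  PresentedGroup.toGroup.of _

end lift

theorem zpowers_le_center :
    Subgroup.zpowers (zElt n k m) ≤ Subgroup.center (ExtGroup n k m) := by
  rw [Subgroup.zpowers_le, Subgroup.mem_center_iff]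
  exact fun g => (zElt_commute g).symm.eq

/-- The projection onto the free product. -/
def toFreeProd (n : ℕ) (m : Fin k → ℕ) : ExtGroup n k m →* FreeProdCyclic n k m :=
  lift (Q := FreeProdCyclic n k m)
    (fun i => Monoid.Coprod.inr (Monoid.CoprodI.of (M := fun i => Multiplicative (ZMod (m i)))
      (i := i) (Multiplicative.ofAdd (1 : ZMod (m i)))))
    (fun j => Monoid.Coprod.inl (FreeGroup.of j)) 1
    (fun i => by
      rw [← map_pow, ← map_pow, ← ofAdd_nsmul, nsmul_one, ZMod.natCast_self, ofAdd_zero, map_one,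
        map_one])
    (fun j => Commute.one_right _)

theorem toFreeProd_surjective (hm : ∀ i, 2 ≤ m i) : Function.Surjective (toFreeProd n m) := by
  intro x
  induction x using Monoid.Coprod.induction_on with
  | inl x =>
    induction x using FreeGroup.induction_on with
    | C1 => exact ⟨1, by simp⟩
    | of j => exact ⟨hElt m j, lift_hElt j⟩
    | inv_of j hj =>
      obtain ⟨g, hg⟩ := hj
      refine ⟨g⁻¹, left_inv_eq_right_inv (a := Monoid.Coprod.inl (FreeGroup.of j)) ?_ ?_⟩
      · rw [← hg, ← map_mul, inv_mul_cancel, map_one]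
      · rw [← map_mul, mul_inv_cancel, map_one]
    | mul x y hx hy =>
      obtain ⟨a, ha⟩ := hx
      obtain ⟨b, hb⟩ := hy
      exact ⟨a * b, by rw [map_mul, map_mul, ha, hb]⟩
  | inr x =>
    induction x using Monoid.CoprodI.induction_on with
    | one => exact ⟨1, by simp⟩
    | of i x =>
      have : NeZero (m i) := ⟨by have := hm i; omega⟩
      refine ⟨eElt n m i ^ (Multiplicative.toAdd x).val, ?_⟩
      rw [map_pow, toFreeProd, lift_eElt, ← map_pow, ← map_pow, ← ofAdd_nsmul, nsmul_one,
        ZMod.natCast_zmod_val, ofAdd_toAdd]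
    | mul x y hx hy =>
      obtain ⟨a, ha⟩ := hx
      obtain ⟨b, hb⟩ := hy
      exact ⟨a * b, by rw [map_mul, map_mul, ha, hb]⟩
  | mul x y hx hy =>
    obtain ⟨a, ha⟩ := hx
    obtain ⟨b, hb⟩ := hy
    exact ⟨a * b, by rw [map_mul, ha, hb]⟩

/-- Modulo `⟨z⟩` the generators satisfy the relations of the free product. This gives a map `σ` back
to the quotient whose composite with the projection is the quotient map, so the kernel is no larger
than `⟨z⟩`. -/
theorem toFreeProd_ker : (toFreeProd n m).ker = Subgroup.zpowers (zElt n k m) := by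
  have hz : toFreeProd n m (zElt n k m) = 1 := lift_zElt
  apply le_antisymm
  · have : (Subgroup.zpowers (zElt n k m)).Normal := ⟨fun x hx g => by
      rwa [Subgroup.mem_center_iff.1 (zpowers_le_center hx) g, mul_inv_cancel_right]⟩
    let q := QuotientGroup.mk' (Subgroup.zpowers (zElt n k m))
    have hq : ∀ i, q (eElt n m i) ^ m i = 1 := fun i => by
      rw [← map_pow, eElt_pow]
      exact (QuotientGroup.eq_one_iff _).2 (Subgroup.mem_zpowers _)
    let c : ∀ i : Fin k, Multiplicative (ZMod (m i)) →*
        ExtGroup n k m ⧸ Subgroup.zpowers (zElt n k m) := fun i =>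
      AddMonoidHom.toMultiplicativeLeft (ZMod.lift (m i)
        ⟨(zmultiplesHom _) (Additive.ofMul (q (eElt n m i))), by
          rw [zmultiplesHom_apply, natCast_zsmul, ← ofMul_pow, hq, ofMul_one]⟩)
    have hc : ∀ i, c i (Multiplicative.ofAdd 1) = q (eElt n m i) := fun i => by
      have := ZMod.lift_coe (m i) (⟨(zmultiplesHom _) (Additive.ofMul (q (eElt n m i))), by
          rw [zmultiplesHom_apply, natCast_zsmul, ← ofMul_pow, hq, ofMul_one]⟩ :
            {f : ℤ →+ Additive (ExtGroup n k m ⧸ Subgroup.zpowers (zElt n k m)) // f (m i) = 0}) 1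
      rw [Int.cast_one] at this
      change Additive.toMul (ZMod.lift (m i) _ 1) = _
      rw [this]
      simp
    let σ : FreeProdCyclic n k m →* ExtGroup n k m ⧸ Subgroup.zpowers (zElt n k m) :=
      Monoid.Coprod.lift (FreeGroup.lift fun j => q (hElt m j)) (Monoid.CoprodI.lift c)
    have hσ : ∀ g, σ (toFreeProd n m g) = q g := by
      intro g
      refine mem_of_generators ((σ.comp (toFreeProd n m)).eqLocus q) (fun i => ?_) (fun j => ?_)
        ?_ g
      · change σ (toFreeProd n m (eElt n m i)) = _
        simp only [toFreeProd, lift_eElt, σ, Monoid.Coprod.lift_apply_inr,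
          Monoid.CoprodI.lift_of, hc]
      · change σ (toFreeProd n m (hElt m j)) = _
        simp only [toFreeProd, lift_hElt, σ, Monoid.Coprod.lift_apply_inl, FreeGroup.lift_apply_of]
      · change σ (toFreeProd n m (zElt n k m)) = _
        rw [hz, map_one]
        exact ((QuotientGroup.eq_one_iff _).2 (Subgroup.mem_zpowers _)).symm
    intro g hg
    rw [← QuotientGroup.eq_one_iff]
    change q g = 1
    rw [← hσ, MonoidHom.mem_ker.1 hg, map_one]
  · rw [Subgroup.zpowers_le]
    exact hz

end ExtGroup

/-! ### Left orders and open conditions on them -/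

namespace LeftOrder

variable {Γ : Type*} [Group Γ]

theorem lt_iff_one_lt (L : LeftOrder Γ) (a b : Γ) : L.lt a b ↔ L.lt 1 (a⁻¹ * b) := by
  constructor
  · intro h
    simpa using L.mul_left a⁻¹ _ _ h
  · intro h
    simpa using L.mul_left a _ _ h

/-- A left order is determined by its positive elements. -/
theorem ext_one_lt {L L' : LeftOrder Γ} (h : ∀ g, L.lt 1 g ↔ L'.lt 1 g) : L = L' := by
  have : L.lt = L'.lt := by
    funext a b
    rw [eq_iff_iff, L.lt_iff_one_lt, L'.lt_iff_one_lt, h]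
  cases L
  cases L'
  cases this
  rfl

/-- The weak order associated with a left order. -/
def le (L : LeftOrder Γ) (a b : Γ) : Prop := L.lt a b ∨ a = b

theorem isOpen_setOf_lt (a b : Γ) : IsOpen {L : LeftOrder Γ | L.lt a b} := by
  by_cases hab : a⁻¹ * b = 1
  · have : {L : LeftOrder Γ | L.lt a b} = ∅ := by
      ext L
      simp only [Set.mem_ofPred_eq, Set.mem_empty_iff_false, iff_false]
      rw [inv_mul_eq_one] at hab
      subst hab
      exact L.strictTotal.irrefl a
    rw [this]
    exact isOpen_empty
  · have hc : Continuous (sign : LeftOrder Γ → _) := continuous_induced_dom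
    have := (isOpen_discrete {true}).preimage
      ((continuous_apply (⟨a⁻¹ * b, hab⟩ : {g : Γ // g ≠ 1})).comp hc)
    convert this using 1
    ext L
    simp [sign, L.lt_iff_one_lt a b]

theorem isOpen_setOf_le (a b : Γ) : IsOpen {L : LeftOrder Γ | L.le a b} := by
  by_cases hab : a = b
  · simp [le, hab]
  · simpa [le, hab] using isOpen_setOf_lt a b

/-- The left order of a group acting on the real line with a free orbit. -/
def ofFreeOrbit (f : Γ → ℝ) (hf : Function.Injective f)
    (h : ∀ g a b, f a < f b → f (g * a) < f (g * b)) : LeftOrder Γ where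
  lt a b := f a < f b
  strictTotal :=
    { trichotomous := fun _ _ h₁ h₂ => hf (le_antisymm (not_lt.1 h₂) (not_lt.1 h₁))
      irrefl := fun _ => lt_irrefl _
      trans := fun _ _ _ => lt_trans }
  mul_left := h

end LeftOrder

/-! ### Ping-pong on a linear order -/

section PingPong

/-- Data for a game of ping-pong on a linear order. The points `V s q`, `0 ≤ q ≤ K`, cut the order
into blocks `(V s q, V s (q + 1)]`; the letter `a` maps the complement of the blocks with index
`exc a` into the blocks with index `tgt a`. -/
structure PingPong {Ω Λ : Type*} [LinearOrder Ω] (K : ℕ) (tgt exc : Λ → ℕ) (t : Λ → ℤ)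
    (V : ℤ → ℕ → Ω) (f : Λ → Ω → Ω) : Prop where
  tgt_lt : ∀ a, tgt a < K
  exc_lt : ∀ a, exc a < K
  mono : ∀ s, ∀ q < K, V s q ≤ V s (q + 1)
  wrap : ∀ s, V s K ≤ V (s + 1) 0
  lower : ∀ a s y, V (s - 1) (exc a + 1) < y → V (s + t a) (tgt a) < f a y
  upper : ∀ a s y, y ≤ V s (exc a) → f a y ≤ V (s + t a) (tgt a + 1)

/-- The index of the block reached by a reduced word. -/
def pingPongLevel {Λ : Type*} (tgt exc : Λ → ℕ) (t : Λ → ℤ) : List Λ → ℤ → ℤ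
  | [], s => s
  | [a], s => s + t a
  | a :: b :: l, s =>
      pingPongLevel tgt exc t (b :: l) s + (if exc a < tgt b then 1 else 0) + t a

namespace PingPong

variable {Ω Λ : Type*} [LinearOrder Ω] {K : ℕ} {tgt exc : Λ → ℕ} {t : Λ → ℤ}
  {V : ℤ → ℕ → Ω} {f : Λ → Ω → Ω}

theorem mono' (P : PingPong K tgt exc t V f) (s : ℤ) {p q : ℕ}
    (hpq : p ≤ q) (hq : q ≤ K) : V s p ≤ V s q := by
  induction q, hpq using Nat.le_induction with
  | base => exact le_rfl
  | succ q _ ih => exact (ih (by omega)).trans (P.mono s q (by omega))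

theorem mono_zero (P : PingPong K tgt exc t V f) {s s' : ℤ} (h : s ≤ s') :
    V s 0 ≤ V s' 0 := by
  induction s', h using Int.leInduction with
  | base => exact le_rfl
  | succ s' _ ih => exact ih.trans ((P.mono' s' (Nat.zero_le K) le_rfl).trans (P.wrap s'))

theorem mono_lt (P : PingPong K tgt exc t V f) {s s' : ℤ} {p q : ℕ}
    (hp : p ≤ K) (hq : q ≤ K) (h : s < s') : V s p ≤ V s' q :=
  (P.mono' s hp le_rfl).trans ((P.wrap s).trans
    ((P.mono_zero (by omega : s + 1 ≤ s')).trans (P.mono' s' (Nat.zero_le q) hq)))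

/-- Reducedness keeps the current point out of the excluded block of the next letter, so each letter
puts it into its target block. Besides the block, the sheet is tracked, and it depends only on the
word and the starting sheet. -/
theorem run (P : PingPong K tgt exc t V f) (a : Λ) (l : List Λ) (s : ℤ) (y : Ω)
    (hl : (a :: l).IsChain fun b c => exc b ≠ tgt c)
    (hy : V (s - 1) (exc ((a :: l).getLast (List.cons_ne_nil a l)) + 1) < y)
    (hy' : y ≤ V s (exc ((a :: l).getLast (List.cons_ne_nil a l)))) :
    V (pingPongLevel tgt exc t (a :: l) s) (tgt a) < (a :: l).foldr f y ∧
      (a :: l).foldr f y ≤ V (pingPongLevel tgt exc t (a :: l) s) (tgt a + 1) := by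
  induction l generalizing a with
  | nil => exact ⟨P.lower a s y hy, P.upper a s y hy'⟩
  | cons b l ih =>
    rw [List.isChain_cons_cons] at hl
    rw [List.getLast_cons (List.cons_ne_nil b l)] at hy hy'
    obtain ⟨h₁, h₂⟩ := ih b hl.2 hy hy'
    have ha := P.exc_lt a
    have hb := P.tgt_lt b
    rw [List.foldr_cons, pingPongLevel]
    set N := pingPongLevel tgt exc t (b :: l) s
    -- The point lies in block `tgt b` of sheet `N`. If this is to the right of the excluded block,
    -- the relevant complementary interval ends at the excluded block of sheet `N + 1`; otherwise at
    -- that of sheet `N`.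
    split_ifs with hab
    · refine ⟨P.lower a _ _ (lt_of_le_of_lt ?_ h₁), P.upper a _ _ (h₂.trans ?_)⟩
      · rw [add_sub_cancel_right]
        exact P.mono' N hab hb.le
      · exact P.mono_lt (by omega) (by omega) (by omega)
    · have hne := hl.1
      refine ⟨P.lower a _ _ (lt_of_le_of_lt ?_ h₁), P.upper a _ _ (h₂.trans ?_)⟩
      · exact P.mono_lt (by omega) (by omega) (by omega)
      · rw [add_zero]
        exact P.mono' N (by omega) ha.le

end PingPong

end PingPong

/-! ### Piecewise linear homeomorphisms commuting with integer translations -/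

section Stretch

/-- The piecewise linear homeomorphism of `[0, 1]` that sends `α` to `β`. -/
noncomputable def bend (α β y : ℝ) : ℝ :=
  if y ≤ α then y * (β / α) else β + (y - α) * ((1 - β) / (1 - α))

variable {α β : ℝ}

theorem bend_mem (hα : 0 < α) (hα' : α < 1) (hβ : 0 < β) (hβ' : β < 1)
    {y : ℝ} (h₀ : 0 ≤ y) (h₁ : y < 1) : 0 ≤ bend α β y ∧ bend α β y < 1 := by
  have h1 : 0 < 1 - α := by linarith
  have h2 : 0 < 1 - β := by linarith
  unfold bend
  split_ifs with h
  · refine ⟨by positivity, lt_of_le_of_lt ?_ hβ'⟩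
    rw [mul_div_assoc', div_le_iff₀ hα]
    nlinarith
  · push Not at h
    refine ⟨by have : 0 < y - α := by linarith
               positivity, ?_⟩
    have : (y - α) * ((1 - β) / (1 - α)) < 1 - β := by
      rw [mul_div_assoc', div_lt_iff₀ h1]
      nlinarith
    linarith

theorem bend_mono (hα : 0 < α) (hα' : α < 1) (hβ : 0 < β) (hβ' : β < 1)
    {x y : ℝ} (h : x ≤ y) : bend α β x ≤ bend α β y := by
  have h1 : 0 < 1 - α := by linarith
  have h2 : 0 < 1 - β := by linarith
  unfold bend
  split_ifs with h3 h4 h4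
  · gcongr
  · have : x * (β / α) ≤ β := by
      rw [mul_div_assoc', div_le_iff₀ hα]
      nlinarith
    have : 0 ≤ (y - α) * ((1 - β) / (1 - α)) := mul_nonneg (by linarith) (by positivity)
    linarith
  · linarith
  · gcongr

theorem bend_bend (hα : 0 < α) (hα' : α < 1) (hβ : 0 < β) (hβ' : β < 1)
    {y : ℝ} : bend β α (bend α β y) = y := by
  have h1 : 0 < 1 - α := by linarith
  have h2 : 0 < 1 - β := by linarith
  by_cases h : y ≤ α
  · have : y * (β / α) ≤ β := by
      rw [mul_div_assoc', div_le_iff₀ hα]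
      nlinarith
    rw [bend, bend, if_pos h, if_pos this]
    field_simp
  · have : 0 < (y - α) * ((1 - β) / (1 - α)) := mul_pos (by linarith) (by positivity)
    rw [bend, bend, if_neg h, if_neg (by linarith)]
    field_simp
    ring

theorem floor_add_bend (hα : 0 < α) (hα' : α < 1) (hβ : 0 < β) (hβ' : β < 1)
    (x : ℝ) :
    ⌊(⌊x⌋ : ℝ) + bend α β (Int.fract x)⌋ = ⌊x⌋ := by
  obtain ⟨h₀, h₁⟩ := bend_mem hα hα' hβ hβ' (Int.fract_nonneg x) (Int.fract_lt_one x)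
  rw [Int.floor_intCast_add, Int.floor_eq_zero_iff.2 ⟨h₀, h₁⟩, add_zero]

theorem fract_add_bend (hα : 0 < α) (hα' : α < 1) (hβ : 0 < β) (hβ' : β < 1)
    (x : ℝ) :
    Int.fract ((⌊x⌋ : ℝ) + bend α β (Int.fract x)) = bend α β (Int.fract x) := by
  rw [Int.fract, floor_add_bend hα hα' hβ hβ']
  ring

/-- The piecewise linear homeomorphism of the line that commutes with integer translations, fixes
`0` and sends `α` to `β`, as a monoid element. -/
noncomputable def stretchLift (hα : 0 < α) (hα' : α < 1) (hβ : 0 < β) (hβ' : β < 1) :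
    CircleDeg1Lift where
  toFun x := ⌊x⌋ + bend α β (Int.fract x)
  monotone' := by
    intro x y hxy
    rcases (Int.floor_mono hxy).lt_or_eq with h | h
    · have h1 := bend_mem hα hα' hβ hβ' (Int.fract_nonneg x) (Int.fract_lt_one x)
      have h2 := bend_mem hα hα' hβ hβ' (Int.fract_nonneg y) (Int.fract_lt_one y)
      have h3 : (⌊x⌋ : ℝ) + 1 ≤ ⌊y⌋ := by exact_mod_cast h
      dsimp only
      linarith
    · dsimp only
      rw [h]
      gcongr
      apply bend_mono hα hα' hβ hβ'
      rw [Int.fract, Int.fract, h]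
      linarith
  map_add_one' x := by
    simp only [Int.floor_add_one, Int.fract_add_one]
    push_cast
    ring

theorem stretchLift_apply (hα : 0 < α) (hα' : α < 1) (hβ : 0 < β) (hβ' : β < 1)
    (x : ℝ) :
    stretchLift hα hα' hβ hβ' x = ⌊x⌋ + bend α β (Int.fract x) := rfl

theorem stretchLift_mul_stretchLift (hα : 0 < α) (hα' : α < 1) (hβ : 0 < β) (hβ' : β < 1) :
    stretchLift hβ hβ' hα hα' * stretchLift hα hα' hβ hβ' = 1 := by
  ext x
  rw [CircleDeg1Lift.mul_apply, stretchLift_apply, stretchLift_apply,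
    floor_add_bend hα hα' hβ hβ', fract_add_bend hα hα' hβ hβ', bend_bend hα hα' hβ hβ',
    Int.floor_add_fract]
  rfl

/-- The piecewise linear homeomorphism of the line that commutes with integer translations, fixes
`0` and sends `α` to `β`. -/
noncomputable def stretch (hα : 0 < α) (hα' : α < 1) (hβ : 0 < β) (hβ' : β < 1) :
    CircleDeg1Liftˣ where
  val := stretchLift hα hα' hβ hβ'
  inv := stretchLift hβ hβ' hα hα'
  val_inv := stretchLift_mul_stretchLift hβ hβ' hα hα'
  inv_val := stretchLift_mul_stretchLift hα hα' hβ hβ'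

theorem stretch_zero (hα : 0 < α) (hα' : α < 1) (hβ : 0 < β) (hβ' : β < 1) :
    stretch hα hα' hβ hβ' 0 = 0 := by
  change stretchLift hα hα' hβ hβ' 0 = 0
  simp [stretchLift_apply, bend, hα.le]

theorem stretch_apply (hα : 0 < α) (hα' : α < 1) (hβ : 0 < β) (hβ' : β < 1) :
    stretch hα hα' hβ hβ' α = β := by
  change stretchLift hα hα' hβ hβ' α = β
  have : ⌊α⌋ = 0 := Int.floor_eq_zero_iff.2 ⟨hα.le, hα'⟩
  rw [stretchLift_apply, Int.fract, this, bend]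
  simp [mul_div_cancel₀ _ hα.ne']

end Stretch

/-! ### Letters, reduced words and cyclic reduction -/

namespace ExtGroup

variable {n k : ℕ} {m : Fin k → ℕ}

/-- Letters: the powers `eᵢ ^ (l + 1)` with `l + 1 < mᵢ`, and the elements `hⱼ` and `hⱼ⁻¹`. -/
abbrev Letter (n : ℕ) (m : Fin k → ℕ) : Type :=
  (Σ i : Fin k, Fin (m i - 1)) ⊕ (Fin (2 * n) × Bool)

namespace Letter

/-- The group element of a letter. -/
def elt : Letter n m → ExtGroup n k m
  | .inl ⟨i, l⟩ => eElt n m i ^ ((l : ℕ) + 1)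
  | .inr (j, true) => hElt m j
  | .inr (j, false) => (hElt m j)⁻¹

/-- The block into which a letter maps. -/
def tgt : Letter n m → ℕ
  | .inl ⟨i, _⟩ => i
  | .inr (j, true) => k + 4 * ((j : ℕ) / 2) + (j : ℕ) % 2
  | .inr (j, false) => k + 4 * ((j : ℕ) / 2) + (j : ℕ) % 2 + 2

/-- The block whose complement is mapped by a letter into its target. -/
def exc : Letter n m → ℕ
  | .inl ⟨i, _⟩ => i
  | .inr (j, true) => k + 4 * ((j : ℕ) / 2) + (j : ℕ) % 2 + 2
  | .inr (j, false) => k + 4 * ((j : ℕ) / 2) + (j : ℕ) % 2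

theorem tgt_lt (a : Letter n m) : a.tgt < k + 4 * n := by
  rcases a with ⟨i, l⟩ | ⟨j, _ | _⟩ <;> simp only [tgt] <;> omega

theorem exc_lt (a : Letter n m) : a.exc < k + 4 * n := by
  rcases a with ⟨i, l⟩ | ⟨j, _ | _⟩ <;> simp only [exc] <;> omega

theorem exists_inl_of_exc_eq_tgt {a : Letter n m} (h : a.exc = a.tgt) :
    ∃ i l, a = .inl ⟨i, l⟩ := by
  rcases a with ⟨i, l⟩ | ⟨j, _ | _⟩ <;> simp [tgt, exc] at h ⊢

theorem exc_eq_tgt_of_exc_lt {a : Letter n m} (h : a.exc < k) : a.exc = a.tgt := by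
  rcases a with ⟨i, l⟩ | ⟨j, _ | _⟩ <;> simp only [tgt, exc] at h ⊢ <;> omega

theorem exc_eq_tgt_of_tgt_lt {a : Letter n m} (h : a.tgt < k) : a.exc = a.tgt := by
  rcases a with ⟨i, l⟩ | ⟨j, _ | _⟩ <;> simp only [tgt, exc] at h ⊢ <;> omega

/-- A product of two letters that is not reduced is a power of `z` or a letter up to a power of
`z`. -/
theorem merge {a b : Letter n m} (h : a.exc = b.tgt) :
    (∃ s : ℤ, a.elt * b.elt = zElt n k m ^ s) ∨
      ∃ (c : Letter n m) (s : ℤ), a.elt * b.elt = c.elt * zElt n k m ^ s ∧ c.exc = b.exc := by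
  rcases a with ⟨i, l⟩ | ⟨j, x⟩
  · rcases b with ⟨i', l'⟩ | ⟨j', _ | _⟩
    · simp only [tgt, exc] at h
      obtain rfl : i = i' := Fin.ext h
      have hl := l.2
      have hl' := l'.2
      rcases lt_trichotomy ((l : ℕ) + 1 + (l' + 1)) (m i) with h1 | h1 | h1
      · refine .inr ⟨.inl ⟨i, ⟨l + l' + 1, by omega⟩⟩, 0, ?_, rfl⟩
        rw [elt, elt, elt, ← pow_add, zpow_zero, mul_one]
        congr 1
        dsimp only
        omega
      · refine .inl ⟨1, ?_⟩
        rw [elt, elt, ← pow_add, h1, eElt_pow, zpow_one]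
      · refine .inr ⟨.inl ⟨i, ⟨l + l' + 1 - m i, by omega⟩⟩, 1, ?_, rfl⟩
        rw [elt, elt, elt, ← pow_add, zpow_one, ← eElt_pow i, ← pow_add]
        congr 1
        dsimp only
        omega
    · simp only [tgt, exc] at h
      omega
    · simp only [tgt, exc] at h
      omega
  · rcases b with ⟨i', l'⟩ | ⟨j', x'⟩
    · have := i'.2
      cases x <;> simp only [tgt, exc] at h <;> omega
    · refine .inl ⟨0, ?_⟩
      have hj : j = j' := by
        apply Fin.ext
        cases x <;> cases x' <;> simp only [tgt, exc] at h <;> omega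
      subst hj
      cases x <;> cases x' <;> simp only [tgt, exc] at h <;> first | omega | simp [elt]

end Letter

open Letter

/-- The product of a word. -/
def wordElt (l : List (Letter n m)) : ExtGroup n k m := (l.map elt).prod

@[simp]
theorem wordElt_nil : wordElt ([] : List (Letter n m)) = 1 := rfl

@[simp]
theorem wordElt_cons (a : Letter n m) (l : List (Letter n m)) :
    wordElt (a :: l) = a.elt * wordElt l := by
  simp [wordElt]

@[simp]
theorem wordElt_append (l l' : List (Letter n m)) :
    wordElt (l ++ l') = wordElt l * wordElt l' := by
  simp [wordElt]

/-- Words in which no two neighbours can be merged. -/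
abbrev Reduced (l : List (Letter n m)) : Prop := l.IsChain fun a b => a.exc ≠ b.tgt

theorem exists_reduced_cons (a : Letter n m) {l : List (Letter n m)} (hl : Reduced l) :
    ∃ (l' : List (Letter n m)) (s : ℤ), Reduced l' ∧ l'.length ≤ l.length + 1 ∧
      a.elt * wordElt l = wordElt l' * zElt n k m ^ s := by
  cases l with
  | nil => exact ⟨[a], 0, List.isChain_singleton a, by simp, by simp⟩
  | cons b l =>
    by_cases hab : a.exc = b.tgt
    · obtain ⟨s, hs⟩ | ⟨c, s, hs, hc⟩ := merge hab
      · refine ⟨l, s, hl.tail, by simp; omega, ?_⟩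
        rw [wordElt_cons, ← mul_assoc, hs, (zElt_zpow_commute s _).eq]
      · refine ⟨c :: l, s, ?_, by simp, ?_⟩
        · rw [Reduced, List.isChain_cons] at hl ⊢
          exact ⟨fun d hd => hc ▸ hl.1 d hd, hl.2⟩
        · rw [wordElt_cons, ← mul_assoc, hs, wordElt_cons, mul_assoc, mul_assoc,
            (zElt_zpow_commute s _).eq]
    · exact ⟨a :: b :: l, 0, List.isChain_cons_cons.2 ⟨hab, hl⟩, by simp, by simp⟩

theorem elt_mul_exists_reduced (a : Letter n m) {g : ExtGroup n k m}
    (hg : ∃ (l : List (Letter n m)) (s : ℤ), Reduced l ∧ g = wordElt l * zElt n k m ^ s) :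
    ∃ (l : List (Letter n m)) (s : ℤ), Reduced l ∧ a.elt * g = wordElt l * zElt n k m ^ s := by
  obtain ⟨l, s, hl, rfl⟩ := hg
  obtain ⟨l', s', hl', -, h⟩ := exists_reduced_cons a hl
  exact ⟨l', s' + s, hl', by rw [← mul_assoc, h, mul_assoc, zpow_add]⟩

theorem zpow_mul_exists_reduced (s' : ℤ) {g : ExtGroup n k m}
    (hg : ∃ (l : List (Letter n m)) (s : ℤ), Reduced l ∧ g = wordElt l * zElt n k m ^ s) :
    ∃ (l : List (Letter n m)) (s : ℤ), Reduced l ∧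
      zElt n k m ^ s' * g = wordElt l * zElt n k m ^ s := by
  obtain ⟨l, s, hl, rfl⟩ := hg
  exact ⟨l, s' + s, hl, by rw [← mul_assoc, (zElt_zpow_commute s' _).eq, mul_assoc, zpow_add]⟩

/-- Elements that preserve the set of such products under left multiplication, together with their
inverses, form a subgroup, and it contains the generators. Uniqueness is not needed here; ping-pong
supplies what is used of it. -/
theorem exists_reduced (hm : ∀ i, 2 ≤ m i) (g : ExtGroup n k m) :
    ∃ (l : List (Letter n m)) (s : ℤ), Reduced l ∧ g = wordElt l * zElt n k m ^ s := by
  let C : ExtGroup n k m → Prop := fun g =>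
    ∃ (l : List (Letter n m)) (s : ℤ), Reduced l ∧ g = wordElt l * zElt n k m ^ s
  let S : Subgroup (ExtGroup n k m) :=
    { carrier := {x | (∀ g, C g → C (x * g)) ∧ ∀ g, C g → C (x⁻¹ * g)}
      one_mem' := ⟨fun g hg => by rwa [one_mul], fun g hg => by rwa [inv_one, one_mul]⟩
      mul_mem' := fun {x y} hx hy => ⟨fun g hg => by
        rw [mul_assoc]; exact hx.1 _ (hy.1 _ hg), fun g hg => by
        rw [mul_inv_rev, mul_assoc]; exact hy.2 _ (hx.2 _ hg)⟩
      inv_mem' := fun {x} hx => ⟨hx.2, fun g hg => by rw [inv_inv]; exact hx.1 g hg⟩ }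
  have h := mem_of_generators S (fun i => ?_) (fun j => ?_) ?_ g
  · simpa [C] using h.1 1 ⟨[], 0, List.isChain_nil, by simp⟩
  · have hi := hm i
    refine ⟨fun g hg => ?_, fun g hg => ?_⟩
    · have := elt_mul_exists_reduced (.inl ⟨i, ⟨0, by omega⟩⟩) hg
      simpa only [elt, zero_add, pow_one] using this
    -- Inverses of `eᵢ` are not letters: `eᵢ⁻¹ = z⁻¹ * eᵢ ^ (mᵢ - 1)`, and the letter for this power
    -- has index `mᵢ - 2`.
    · have := zpow_mul_exists_reduced (-1)
        (elt_mul_exists_reduced (.inl ⟨i, ⟨m i - 2, by omega⟩⟩) hg)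
      rw [← mul_assoc] at this
      convert this using 2
      rw [elt, zpow_neg_one, eq_inv_mul_iff_mul_eq, ← eElt_pow i, mul_inv_eq_iff_eq_mul,
        ← pow_succ]
      congr 1
      dsimp only
      omega
  · exact ⟨fun g hg => elt_mul_exists_reduced (.inr (j, true)) hg,
      fun g hg => elt_mul_exists_reduced (.inr (j, false)) hg⟩
  · refine ⟨fun g hg => ?_, fun g hg => ?_⟩
    · simpa only [zpow_one] using zpow_mul_exists_reduced 1 hg
    · simpa only [zpow_neg_one] using zpow_mul_exists_reduced (-1) hg

/-- Cyclic reduction of a reduced word. -/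
theorem exists_conj_wordElt (N : ℕ) (l : List (Letter n m)) (hl : Reduced l) (hN : l.length ≤ N) :
    ∃ (x : ExtGroup n k m) (l' : List (Letter n m)) (s : ℤ), Reduced l' ∧
      x * wordElt l * x⁻¹ = wordElt l' * zElt n k m ^ s ∧
      (l' = [] ∨ (∃ i r, l' = [.inl ⟨i, r⟩]) ∨
        ∃ a l₁, l' = a :: l₁ ∧ ((a :: l₁).getLast (List.cons_ne_nil a l₁)).exc ≠ a.tgt) := by
  induction N generalizing l with
  | zero =>
    obtain rfl : l = [] := List.length_eq_zero_iff.1 (by omega)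
    exact ⟨1, [], 0, hl, by simp, .inl rfl⟩
  | succ N ih =>
    rcases l with - | ⟨a, l⟩
    · exact ⟨1, [], 0, hl, by simp, .inl rfl⟩
    rcases l.eq_nil_or_concat with rfl | ⟨mid, b, rfl⟩
    · by_cases ha : a.exc = a.tgt
      · obtain ⟨i, r, rfl⟩ := exists_inl_of_exc_eq_tgt ha
        exact ⟨1, _, 0, hl, by simp, .inr (.inl ⟨i, r, rfl⟩)⟩
      · exact ⟨1, _, 0, hl, by simp, .inr (.inr ⟨a, [], rfl, ha⟩)⟩
    · rw [List.concat_eq_append] at *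
      by_cases hab : b.exc = a.tgt
      · have hmid : Reduced mid := by
          have := hl.tail
          simp only [List.tail_cons] at this
          exact this.left_of_append
        -- Conjugating by the last letter brings it next to the first one, where the two merge and
        -- the word gets shorter.
        have hconj : b.elt * wordElt (a :: (mid ++ [b])) * b.elt⁻¹ =
            b.elt * a.elt * wordElt mid := by
          simp [mul_assoc]
        have ham : Reduced (a :: mid) := by
          rw [← List.cons_append] at hl
          exact hl.left_of_append
        simp only [List.length_cons, List.length_append, List.length_nil] at hN
        obtain ⟨s, hs⟩ | ⟨c, s, hs, hc⟩ := merge hab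
        · obtain ⟨x, l', s', hl', h, h'⟩ := ih mid hmid (by omega)
          refine ⟨x * b.elt, l', s' + s, hl', ?_, h'⟩
          calc x * b.elt * wordElt (a :: (mid ++ [b])) * (x * b.elt)⁻¹
              = x * (b.elt * wordElt (a :: (mid ++ [b])) * b.elt⁻¹) * x⁻¹ := by group
            _ = x * wordElt mid * x⁻¹ * zElt n k m ^ s := by
              rw [hconj, hs, (zElt_zpow_commute s _).eq, ← mul_assoc, mul_assoc (x * wordElt mid),
                (zElt_zpow_commute s _).eq, ← mul_assoc]
            _ = _ := by rw [h, zpow_add, mul_assoc]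
        · have hcm : Reduced (c :: mid) := by
            rw [Reduced, List.isChain_cons] at ham ⊢
            exact ⟨fun d hd => hc ▸ ham.1 d hd, ham.2⟩
          obtain ⟨x, l', s', hl', h, h'⟩ := ih (c :: mid) hcm (by simp; omega)
          refine ⟨x * b.elt, l', s' + s, hl', ?_, h'⟩
          calc x * b.elt * wordElt (a :: (mid ++ [b])) * (x * b.elt)⁻¹
              = x * (b.elt * wordElt (a :: (mid ++ [b])) * b.elt⁻¹) * x⁻¹ := by group
            _ = x * wordElt (c :: mid) * x⁻¹ * zElt n k m ^ s := by
              rw [hconj, hs, wordElt_cons, mul_assoc c.elt, (zElt_zpow_commute s _).eq,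
                ← mul_assoc c.elt, ← mul_assoc, mul_assoc (x * _), (zElt_zpow_commute s _).eq,
                ← mul_assoc]
            _ = _ := by rw [h, zpow_add, mul_assoc]
      · exact ⟨1, _, 0, hl, by simp, .inr (.inr ⟨a, mid ++ [b], rfl, by
          simpa using hab⟩)⟩

/-- Every element is conjugate to a power of `z`, or up to a power of `z` to a power of some `eᵢ`
or to a cyclically reduced word. -/
theorem exists_conj_cyclicallyReduced (hm : ∀ i, 2 ≤ m i) (g : ExtGroup n k m) :
    ∃ (x : ExtGroup n k m) (l : List (Letter n m)) (s : ℤ), Reduced l ∧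
      x * g * x⁻¹ = wordElt l * zElt n k m ^ s ∧
      (l = [] ∨ (∃ i r, l = [.inl ⟨i, r⟩]) ∨
        ∃ a l₁, l = a :: l₁ ∧ ((a :: l₁).getLast (List.cons_ne_nil a l₁)).exc ≠ a.tgt) := by
  obtain ⟨l, s, hl, rfl⟩ := exists_reduced hm g
  obtain ⟨x, l', s', hl', h, h'⟩ := exists_conj_wordElt l.length l hl le_rfl
  refine ⟨x, l', s' + s, hl', ?_, h'⟩
  rw [zpow_add, ← mul_assoc (wordElt l'), ← h, ← mul_assoc x, mul_assoc (x * wordElt l),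
    (zElt_zpow_commute s _).eq, ← mul_assoc]

end ExtGroup

/-! ### The action on the line and its ping-pong dynamics -/

namespace ExtGroup

open Letter CircleDeg1Lift

variable {n k : ℕ} {m : Fin k → ℕ}

/-- The points that cut the circle into blocks. -/
noncomputable def cutPt (n k q : ℕ) : ℝ := q / ((k + 4 * n : ℕ) + 1)

theorem cutPt_zero : cutPt n k 0 = 0 := by simp [cutPt]

theorem cutPt_strictMono : StrictMono (cutPt n k) := by
  intro p q h
  unfold cutPt
  gcongr

theorem cutPt_nonneg (q : ℕ) : 0 ≤ cutPt n k q := by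
  unfold cutPt
  positivity

theorem cutPt_lt_one {q : ℕ} (hq : q ≤ k + 4 * n) : cutPt n k q < 1 := by
  unfold cutPt
  rw [div_lt_one (by positivity)]
  have : (q : ℝ) ≤ (k + 4 * n : ℕ) := by exact_mod_cast hq
  linarith

theorem cutPt_succ (q : ℕ) : cutPt n k (q + 1) = cutPt n k q + cutPt n k 1 := by
  unfold cutPt
  push_cast
  ring

theorem cutPt_one_pos : 0 < cutPt n k 1 := by
  unfold cutPt
  positivity

theorem cutPt_one_lt (hk : 1 ≤ k) : cutPt n k 1 < 1 := cutPt_lt_one (by omega)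

theorem rotation_pos {r : ℕ} (hr : 2 ≤ r) : 0 < ((r : ℝ) - 1) / r := by
  have : (2 : ℝ) ≤ r := by exact_mod_cast hr
  apply div_pos <;> linarith

theorem rotation_lt_one {r : ℕ} (hr : 2 ≤ r) : ((r : ℝ) - 1) / r < 1 := by
  have : (2 : ℝ) ≤ r := by exact_mod_cast hr
  rw [div_lt_one (by linarith)]
  linarith

theorem commute_translate_one (f : CircleDeg1Liftˣ) :
    Commute f (CircleDeg1Lift.translate (.ofAdd 1)) := by
  apply Units.ext
  ext x
  rw [Units.val_mul, Units.val_mul, mul_apply, mul_apply, translate_apply, translate_apply,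
    map_one_add]

/-- The homeomorphism by which `eᵢ` acts on the line: a conjugate of the translation by `1 / mᵢ`. -/
noncomputable def eAct (n : ℕ) (hk : 1 ≤ k) (hm : ∀ i, 2 ≤ m i) (i : Fin k) : CircleDeg1Liftˣ :=
  CircleDeg1Lift.translate (.ofAdd (cutPt n k i)) *
    (stretch (cutPt_one_pos (n := n) (k := k)) (cutPt_one_lt hk) (rotation_pos (hm i))
      (rotation_lt_one (hm i)))⁻¹ * CircleDeg1Lift.translate (.ofAdd (1 / (m i : ℝ))) *
    ((CircleDeg1Lift.translate (.ofAdd (cutPt n k i))) *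
    (stretch (cutPt_one_pos (n := n) (k := k)) (cutPt_one_lt hk) (rotation_pos (hm i))
      (rotation_lt_one (hm i)))⁻¹)⁻¹

theorem eAct_pow (hk : 1 ≤ k) (hm : ∀ i, 2 ≤ m i) (i : Fin k) :
    eAct n hk hm i ^ m i = CircleDeg1Lift.translate (.ofAdd 1) := by
  have h : (m i : ℝ) ≠ 0 := by
    have := hm i
    exact_mod_cast (by omega : m i ≠ 0)
  rw [eAct, conj_pow, translate_pow, mul_one_div_cancel h, mul_inv_eq_iff_eq_mul]
  exact commute_translate_one _

/-- The stretch gives the block length `(mᵢ - 1) / mᵢ` and so leaves length `1 / mᵢ` for the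
complement. In this coordinate translation by `1 / mᵢ` carries the complement onto the first piece
of the block. -/
theorem eAct_apply (hk : 1 ≤ k) (hm : ∀ i, 2 ≤ m i) (i : Fin k) :
    eAct n hk hm i (cutPt n k (i + 1) - 1) = cutPt n k i := by
  have h : (m i : ℝ) ≠ 0 := by
    have := hm i
    exact_mod_cast (by omega : m i ≠ 0)
  rw [eAct]
  set S := stretch (cutPt_one_pos (n := n) (k := k)) (cutPt_one_lt hk) (rotation_pos (hm i))
      (rotation_lt_one (hm i)) with hS
  have h1 : S (cutPt n k 1 - 1) = -(1 / (m i : ℝ)) := by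
    have := map_sub_nat S (cutPt n k 1) 1
    rw [Nat.cast_one, stretch_apply] at this
    rw [this]
    field_simp
    ring
  have h2 : (S⁻¹ : CircleDeg1Liftˣ) 0 = 0 := by
    have := units_inv_apply_apply S 0
    rwa [hS, stretch_zero] at this
  rw [mul_inv_rev, inv_inv]
  simp only [Units.val_mul, mul_apply, translate_apply, translate_inv_apply]
  rw [cutPt_succ, show -cutPt n k i + (cutPt n k i + cutPt n k 1 - 1) = cutPt n k 1 - 1 by ring,
    h1, add_neg_cancel, h2, add_zero]

/-- The homeomorphism by which `hⱼ` acts on the line. -/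
noncomputable def hAct (m : Fin k → ℕ) (hk : 1 ≤ k) (j : Fin (2 * n)) : CircleDeg1Liftˣ :=
  CircleDeg1Lift.translate (.ofAdd (cutPt n k (tgt (m := m) (.inr (j, true))))) *
    stretch (sub_pos.2 (cutPt_one_lt (n := n) hk)) (sub_lt_self 1 cutPt_one_pos)
      (cutPt_one_pos (n := n) (k := k)) (cutPt_one_lt hk) *
    CircleDeg1Lift.translate (.ofAdd (1 - cutPt n k (exc (m := m) (.inr (j, true)) + 1)))

/-- `hAct` shrinks the complement of the excluded block, of length `1 - cutPt n k 1`, onto the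
target block, of length `cutPt n k 1`. This is the left end; `hAct_apply_upper` is the right end. -/
theorem hAct_apply_lower (hk : 1 ≤ k) (j : Fin (2 * n)) :
    hAct m hk j (cutPt n k (exc (m := m) (.inr (j, true)) + 1) - 1) =
      cutPt n k (tgt (m := m) (.inr (j, true))) := by
  simp only [hAct, Units.val_mul, mul_apply, translate_apply]
  rw [sub_add_sub_cancel, sub_self, stretch_zero, add_zero]

theorem hAct_apply_upper (hk : 1 ≤ k) (j : Fin (2 * n)) :
    hAct m hk j (cutPt n k (exc (m := m) (.inr (j, true)))) =
      cutPt n k (tgt (m := m) (.inr (j, true)) + 1) := by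
  simp only [hAct, Units.val_mul, mul_apply, translate_apply]
  rw [cutPt_succ (exc _), cutPt_succ (tgt _)]
  rw [show 1 - (cutPt n k (exc (m := m) (.inr (j, true))) + cutPt n k 1) +
    cutPt n k (exc (m := m) (.inr (j, true))) = 1 - cutPt n k 1 by ring, stretch_apply]

/-- The action of the group on the line. -/
noncomputable def lineHom (hk : 1 ≤ k) (hm : ∀ i, 2 ≤ m i) : ExtGroup n k m →* CircleDeg1Liftˣ :=
  lift (eAct n hk hm) (hAct m hk) (CircleDeg1Lift.translate (.ofAdd 1)) (eAct_pow hk hm)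
    fun _ => commute_translate_one _

/-- The action of the group on the line, as functions. -/
noncomputable def move (hk : 1 ≤ k) (hm : ∀ i, 2 ≤ m i) (g : ExtGroup n k m) (x : ℝ) : ℝ :=
  lineHom hk hm g x

section move

variable (hk : 1 ≤ k) (hm : ∀ i, 2 ≤ m i)

@[simp]
theorem move_one (x : ℝ) : move hk hm (1 : ExtGroup n k m) x = x := by
  simp [move]

theorem move_mul (g h : ExtGroup n k m) (x : ℝ) :
    move hk hm (g * h) x = move hk hm g (move hk hm h x) := by
  simp [move]

theorem move_strictMono (g : ExtGroup n k m) : StrictMono (move hk hm g) :=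
  (toOrderIso (lineHom hk hm g)).strictMono

theorem move_zpow (s : ℤ) (x : ℝ) : move hk hm (zElt n k m ^ s) x = x + s := by
  rw [move, map_zpow, lineHom, lift_zElt, translate_zpow, translate_apply]
  ring

theorem move_add_int (g : ExtGroup n k m) (x : ℝ) (s : ℤ) :
    move hk hm g (x + s) = move hk hm g x + s :=
  map_add_int _ x s

theorem move_zpow_mul (g : ExtGroup n k m) (s : ℤ) (x : ℝ) :
    move hk hm (zElt n k m ^ s * g) x = move hk hm g x + s := by
  rw [move_mul, move_zpow]

theorem move_mul_zpow (g : ExtGroup n k m) (s : ℤ) (x : ℝ) :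
    move hk hm (g * zElt n k m ^ s) x = move hk hm g x + s := by
  rw [move_mul, move_zpow, move_add_int]

theorem move_eElt (i : Fin k) :
    move hk hm (eElt n m i) (cutPt n k (i + 1) - 1) = cutPt n k i := by
  rw [move, lineHom, lift_eElt, eAct_apply]

theorem lt_move_eElt (i : Fin k) : cutPt n k i < move hk hm (eElt n m i) (cutPt n k i) := by
  conv_lhs => rw [← move_eElt hk hm i]
  apply move_strictMono
  rw [cutPt_succ]
  linarith [cutPt_one_lt (n := n) hk]

theorem move_eElt_pow_succ (i : Fin k) (l : ℕ) :
    move hk hm (eElt n m i ^ (l + 1)) (cutPt n k (i + 1) - 1) =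
      move hk hm (eElt n m i ^ l) (cutPt n k i) := by
  rw [pow_succ, move_mul, move_eElt]

theorem move_eElt_pow_mono (i : Fin k) :
    StrictMono fun l : ℕ => move hk hm (eElt n m i ^ l) (cutPt n k i) := by
  refine strictMono_nat_of_lt_succ fun l => ?_
  rw [pow_succ, move_mul]
  exact move_strictMono hk hm _ (lt_move_eElt hk hm i)

theorem move_eElt_pow_pred (i : Fin k) :
    move hk hm (eElt n m i ^ (m i - 1)) (cutPt n k i) = cutPt n k (i + 1) := by
  have hi := hm i
  rw [← move_eElt_pow_succ, Nat.sub_add_cancel (by omega), eElt_pow]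
  have := move_zpow (n := n) hk hm 1 (cutPt n k (i + 1) - 1)
  rw [zpow_one] at this
  rw [this]
  simp

theorem le_move_eElt_pow (i : Fin k) (l : ℕ) :
    cutPt n k i ≤ move hk hm (eElt n m i ^ l) (cutPt n k i) := by
  simpa using (move_eElt_pow_mono (n := n) hk hm i).monotone (Nat.zero_le l)

theorem move_eElt_pow_le (i : Fin k) {l : ℕ} (hl : l ≤ m i - 1) :
    move hk hm (eElt n m i ^ l) (cutPt n k i) ≤ cutPt n k (i + 1) := by
  rw [← move_eElt_pow_pred hk hm]
  exact (move_eElt_pow_mono (n := n) hk hm i).monotone hl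

theorem move_hElt_lower (j : Fin (2 * n)) :
    move hk hm (hElt m j) (cutPt n k (exc (m := m) (.inr (j, true)) + 1) - 1) =
      cutPt n k (tgt (m := m) (.inr (j, true))) := by
  rw [move, lineHom, lift_hElt, hAct_apply_lower]

theorem move_hElt_upper (j : Fin (2 * n)) :
    move hk hm (hElt m j) (cutPt n k (exc (m := m) (.inr (j, true)))) =
      cutPt n k (tgt (m := m) (.inr (j, true)) + 1) := by
  rw [move, lineHom, lift_hElt, hAct_apply_upper]

theorem move_hElt_inv_lower (j : Fin (2 * n)) :
    move hk hm (hElt m j)⁻¹ (cutPt n k (tgt (m := m) (.inr (j, true)) + 1) - 1) =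
      cutPt n k (exc (m := m) (.inr (j, true))) - 1 := by
  rw [← move_hElt_upper hk hm]
  have := move_add_int hk hm (hElt m j) (cutPt n k (exc (m := m) (.inr (j, true)))) (-1)
  push_cast at this
  rw [← sub_eq_add_neg, ← sub_eq_add_neg] at this
  rw [← this, ← move_mul, inv_mul_cancel, move_one]

theorem move_hElt_inv_upper (j : Fin (2 * n)) :
    move hk hm (hElt m j)⁻¹ (cutPt n k (tgt (m := m) (.inr (j, true)))) =
      cutPt n k (exc (m := m) (.inr (j, true)) + 1) - 1 := by
  rw [← move_hElt_lower hk hm, ← move_mul, inv_mul_cancel, move_one]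

end move

/-- The amount by which letters shift blocks, when `eᵢ` is followed by `z ^ δᵢ`. -/
def Letter.shift (δ : Fin k → ℤ) : Letter n m → ℤ
  | .inl ⟨i, l⟩ => ((l : ℕ) + 1 : ℕ) * δ i
  | .inr (_, true) => 0
  | .inr (_, false) => -1

section move

variable (hk : 1 ≤ k) (hm : ∀ i, 2 ≤ m i)

/-- By monotonicity and commutation with integer translations it is enough to know the images of the
two ends of a complementary interval. The value `-1` of the shift at `hⱼ⁻¹` appears because
inverting `hAct` lands one sheet lower. -/
theorem pingPong_line : PingPong (k + 4 * n) (Letter.tgt (n := n) (m := m)) Letter.exc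
    (Letter.shift 0) (fun s q => cutPt n k q + s) (fun a y => move hk hm a.elt y) where
  tgt_lt := Letter.tgt_lt
  exc_lt := Letter.exc_lt
  mono s q _ := by
    gcongr
    exact cutPt_strictMono.monotone q.le_succ
  wrap s := by
    have := cutPt_lt_one (n := n) (k := k) le_rfl
    rw [cutPt_zero]
    push_cast
    linarith
  lower a s y hy := by
    have hy' : cutPt n k (exc a + 1) - 1 < y - s := by
      push_cast at hy
      linarith
    have h := move_strictMono hk hm a.elt hy'
    rw [sub_eq_add_neg y, ← Int.cast_neg, move_add_int] at h
    push_cast at h ⊢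
    rcases a with ⟨i, l⟩ | ⟨j, _ | _⟩
    · simp only [elt, exc, move_eElt_pow_succ] at h
      have := le_move_eElt_pow (n := n) hk hm i l
      simp only [elt, tgt, Letter.shift, Pi.zero_apply, mul_zero, Int.cast_zero]
      linarith
    · have := move_hElt_inv_lower hk hm j
      simp only [elt, tgt, exc, Letter.shift] at h this ⊢
      rw [this] at h
      push_cast
      linarith
    · have := move_hElt_lower hk hm j
      simp only [elt, tgt, exc, Letter.shift] at h this ⊢
      rw [this] at h
      push_cast
      linarith
  upper a s y hy := by
    have hy' : y - s ≤ cutPt n k (exc a) := by linarith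
    have h := (move_strictMono hk hm a.elt).monotone hy'
    rw [sub_eq_add_neg y, ← Int.cast_neg, move_add_int] at h
    push_cast at h ⊢
    rcases a with ⟨i, l⟩ | ⟨j, _ | _⟩
    · simp only [elt, exc] at h
      have := move_eElt_pow_le (n := n) hk hm i (l := l + 1) (by omega)
      simp only [elt, tgt, Letter.shift, Pi.zero_apply, mul_zero, Int.cast_zero]
      linarith
    · have := move_hElt_inv_upper hk hm j
      simp only [elt, tgt, exc, Letter.shift] at h this ⊢
      rw [this] at h
      push_cast
      linarith
    · have := move_hElt_upper hk hm j
      simp only [elt, tgt, exc, Letter.shift] at h this ⊢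
      rw [this] at h
      push_cast
      linarith

theorem foldr_move (l : List (Letter n m)) (y : ℝ) :
    l.foldr (fun a y => move hk hm a.elt y) y = move hk hm (wordElt l) y := by
  induction l with
  | nil => simp
  | cons a l ih => rw [List.foldr_cons, ih, wordElt_cons, move_mul]

/-- The block into which a reduced word maps. -/
theorem move_wordElt_mem (a : Letter n m) (l : List (Letter n m)) (hl : Reduced (a :: l)) (s : ℤ) :
    ∃ N : ℤ, ∀ y, cutPt n k (((a :: l).getLast (List.cons_ne_nil a l)).exc + 1) + (s - 1) < y →
      y ≤ cutPt n k ((a :: l).getLast (List.cons_ne_nil a l)).exc + s →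
      cutPt n k a.tgt + N < move hk hm (wordElt (a :: l)) y ∧
        move hk hm (wordElt (a :: l)) y ≤ cutPt n k (a.tgt + 1) + N := by
  refine ⟨pingPongLevel Letter.tgt Letter.exc (Letter.shift 0) (a :: l) s, fun y hy hy' => ?_⟩
  have := (pingPong_line (n := n) hk hm).run a l s y hl (by push_cast; exact hy) hy'
  rw [foldr_move] at this
  exact this

theorem move_wordElt_zero_mem (a : Letter n m) (l : List (Letter n m)) (hl : Reduced (a :: l)) :
    ∃ N : ℤ, cutPt n k a.tgt + N < move hk hm (wordElt (a :: l)) 0 ∧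
      move hk hm (wordElt (a :: l)) 0 ≤ cutPt n k (a.tgt + 1) + N := by
  obtain ⟨N, hN⟩ := move_wordElt_mem hk hm a l hl 0
  refine ⟨N, hN 0 ?_ ?_⟩
  · have := cutPt_lt_one (n := n) (k := k)
      (Letter.exc_lt ((a :: l).getLast (List.cons_ne_nil a l)))
    push_cast
    linarith
  · simpa using cutPt_nonneg _

/-- The point `0` has a free orbit. -/
theorem eq_one_of_move_zero {g : ExtGroup n k m} (h : move hk hm g 0 = 0) : g = 1 := by
  obtain ⟨l, s, hl, rfl⟩ := exists_reduced hm g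
  rw [move_mul_zpow] at h
  rcases l with - | ⟨a, l⟩
  · rw [wordElt_nil, move_one, zero_add, Int.cast_eq_zero] at h
    simp [h]
  · obtain ⟨N, h1, h2⟩ := move_wordElt_zero_mem hk hm a l hl
    have h3 := cutPt_nonneg (n := n) (k := k) a.tgt
    have h4 := cutPt_lt_one (n := n) (k := k) (Letter.tgt_lt a)
    have h5 : ((N + s : ℤ) : ℝ) < (0 : ℤ) := by push_cast; linarith
    have h6 : ((-1 : ℤ) : ℝ) < (N + s : ℤ) := by push_cast; linarith
    rw [Int.cast_lt] at h5 h6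
    omega

theorem zElt_zpow_injective (hk : 1 ≤ k) (hm : ∀ i, 2 ≤ m i) :
    Function.Injective fun s : ℤ => zElt n k m ^ s := by
  intro s s' h
  have := congrArg (fun g => move hk hm g 0) h
  simpa [move_zpow] using this

theorem not_isOfFinOrder_zElt (hk : 1 ≤ k) (hm : ∀ i, 2 ≤ m i) :
    ¬ IsOfFinOrder (zElt n k m) := by
  rw [← injective_zpow_iff_not_isOfFinOrder]
  exact zElt_zpow_injective hk hm

end move

end ExtGroup

/-! ### Cut elements and the boundary element -/

namespace ExtGroup

open Letter

variable {n k : ℕ} {m : Fin k → ℕ}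

/-- The quotient of two consecutive cut elements. -/
def cutStep (n : ℕ) (m : Fin k → ℕ) (q : ℕ) : ExtGroup n k m :=
  if h : q < k then eElt n m ⟨q, h⟩ ^ (m ⟨q, h⟩ - 1)
  else if h' : (q - k) / 4 < n then
    let a : ExtGroup n k m := hElt m ⟨2 * ((q - k) / 4), by omega⟩
    let b : ExtGroup n k m := hElt m ⟨2 * ((q - k) / 4) + 1, by omega⟩
    match (q - k) % 4 with
    | 0 => zElt n k m * a * b * a⁻¹
    | 1 => a⁻¹
    | 2 => b⁻¹
    | _ => zElt n k m * b⁻¹ * a * b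
  else 1

/-- Elements that move the left end of the first block to the ends of the other blocks. -/
def cutElt (n : ℕ) (m : Fin k → ℕ) : ℕ → ExtGroup n k m
  | 0 => 1
  | q + 1 => cutStep n m q * cutElt n m q

theorem cutElt_succ (q : ℕ) : cutElt n m (q + 1) = cutStep n m q * cutElt n m q := rfl

theorem cutElt_succ_fin (i : Fin k) :
    cutElt n m (i + 1) = eElt n m i ^ (m i - 1) * cutElt n m i := by
  rw [cutElt_succ, cutStep, dif_pos i.2]

section pairs

variable {p : ℕ} (hp : p < n)

theorem cutElt_pair_one : cutElt n m (k + 4 * p + 1) =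
    zElt n k m * hElt m ⟨2 * p, by omega⟩ * hElt m ⟨2 * p + 1, by omega⟩ *
      (hElt m ⟨2 * p, by omega⟩)⁻¹ * cutElt n m (k + 4 * p) := by
  have h1 : (k + 4 * p - k) / 4 = p := by omega
  have h2 : (k + 4 * p - k) % 4 = 0 := by omega
  rw [cutElt_succ, cutStep, dif_neg (by omega), dif_pos (by omega)]
  simp only [h1, h2]

theorem cutElt_pair_two : cutElt n m (k + 4 * p + 2) =
    (hElt m ⟨2 * p, by omega⟩)⁻¹ * cutElt n m (k + 4 * p + 1) := by
  have h1 : (k + 4 * p + 1 - k) / 4 = p := by omega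
  have h2 : (k + 4 * p + 1 - k) % 4 = 1 := by omega
  rw [cutElt_succ (k + 4 * p + 1), cutStep, dif_neg (by omega), dif_pos (by omega)]
  simp only [h1, h2]

theorem cutElt_pair_three : cutElt n m (k + 4 * p + 3) =
    (hElt m ⟨2 * p + 1, by omega⟩)⁻¹ * cutElt n m (k + 4 * p + 2) := by
  have h1 : (k + 4 * p + 2 - k) / 4 = p := by omega
  have h2 : (k + 4 * p + 2 - k) % 4 = 2 := by omega
  rw [cutElt_succ (k + 4 * p + 2), cutStep, dif_neg (by omega), dif_pos (by omega)]
  simp only [h1, h2]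

theorem cutElt_pair_four : cutElt n m (k + 4 * p + 4) =
    zElt n k m * (hElt m ⟨2 * p + 1, by omega⟩)⁻¹ * hElt m ⟨2 * p, by omega⟩ *
      hElt m ⟨2 * p + 1, by omega⟩ * cutElt n m (k + 4 * p + 3) := by
  have h1 : (k + 4 * p + 3 - k) / 4 = p := by omega
  have h2 : (k + 4 * p + 3 - k) % 4 = 3 := by omega
  rw [cutElt_succ (k + 4 * p + 3), cutStep, dif_neg (by omega), dif_pos (by omega)]
  simp only [h1, h2]

theorem hElt_even_mul_lower : hElt m ⟨2 * p, by omega⟩ * cutElt n m (k + 4 * p + 3) =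
    zElt n k m * cutElt n m (k + 4 * p) := by
  rw [cutElt_pair_three hp, cutElt_pair_two hp, cutElt_pair_one hp]
  set a : ExtGroup n k m := hElt m ⟨2 * p, by omega⟩
  set b : ExtGroup n k m := hElt m ⟨2 * p + 1, by omega⟩
  set u := cutElt n m (k + 4 * p)
  calc a * (b⁻¹ * (a⁻¹ * (zElt n k m * a * b * a⁻¹ * u)))
      = a * b⁻¹ * a⁻¹ * zElt n k m * (a * b * a⁻¹ * u) := by group
    _ = zElt n k m * u := by
      rw [← (zElt_commute (a * b⁻¹ * a⁻¹)).eq]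
      group

theorem hElt_even_mul_upper : hElt m ⟨2 * p, by omega⟩ * cutElt n m (k + 4 * p + 2) =
    cutElt n m (k + 4 * p + 1) := by
  rw [cutElt_pair_two hp, mul_inv_cancel_left]

theorem hElt_odd_mul_upper : hElt m ⟨2 * p + 1, by omega⟩ * cutElt n m (k + 4 * p + 3) =
    cutElt n m (k + 4 * p + 2) := by
  rw [cutElt_pair_three hp, mul_inv_cancel_left]

theorem hElt_odd_mul_lower : hElt m ⟨2 * p + 1, by omega⟩ * cutElt n m (k + 4 * p + 4) =
    zElt n k m * cutElt n m (k + 4 * p + 1) := by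
  rw [cutElt_pair_four hp, ← hElt_even_mul_upper hp, ← hElt_odd_mul_upper hp,
    mul_assoc (zElt n k m), mul_assoc (zElt n k m), mul_assoc (zElt n k m),
    ← mul_assoc _ (zElt n k m), ← (zElt_commute _).eq, mul_assoc]
  congr 1
  group

end pairs

/-- The group-level counterpart of `move_hElt_lower`. Over one pair of generators `a`, `b`, the
steps multiply to `z ^ 2` times a commutator; `cutStep` is chosen so that the gluings by `a` and `b`
hold as identities in the group. -/
theorem hElt_mul_cutElt_lower (j : Fin (2 * n)) :
    hElt m j * cutElt n m (exc (m := m) (.inr (j, true)) + 1) =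
      zElt n k m * cutElt n m (tgt (m := m) (.inr (j, true))) := by
  obtain ⟨j, hj⟩ := j
  simp only [exc, tgt]
  rcases Nat.even_or_odd' j with ⟨p, rfl | rfl⟩
  · have h1 : 2 * p / 2 = p := by omega
    have h2 : 2 * p % 2 = 0 := by omega
    rw [h1, h2]
    exact hElt_even_mul_lower (by omega)
  · have h1 : (2 * p + 1) / 2 = p := by omega
    have h2 : (2 * p + 1) % 2 = 1 := by omega
    rw [h1, h2]
    exact hElt_odd_mul_lower (by omega)

theorem hElt_mul_cutElt_upper (j : Fin (2 * n)) :
    hElt m j * cutElt n m (exc (m := m) (.inr (j, true))) =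
      cutElt n m (tgt (m := m) (.inr (j, true)) + 1) := by
  obtain ⟨j, hj⟩ := j
  simp only [exc, tgt]
  rcases Nat.even_or_odd' j with ⟨p, rfl | rfl⟩
  · have h1 : 2 * p / 2 = p := by omega
    have h2 : 2 * p % 2 = 0 := by omega
    rw [h1, h2]
    exact hElt_even_mul_upper (by omega)
  · have h1 : (2 * p + 1) / 2 = p := by omega
    have h2 : (2 * p + 1) % 2 = 1 := by omega
    rw [h1, h2]
    exact hElt_odd_mul_upper (by omega)

/-- The inverse of the element that stabilizes the gap between the last and the first block. -/
def cuspElt (n : ℕ) (m : Fin k → ℕ) : ExtGroup n k m :=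
  cutElt n m (k + 4 * n) * (zElt n k m)⁻¹

section line

variable (hk : 1 ≤ k) (hm : ∀ i, 2 ≤ m i)

theorem move_elt_lower (a : Letter n m) {y : ℝ} (hy : cutPt n k (a.exc + 1) - 1 < y) :
    cutPt n k a.tgt + (a.shift 0 : ℤ) < move hk hm a.elt y := by
  have := (pingPong_line (n := n) hk hm).lower a 0 y (by
    push_cast
    linarith)
  simpa using this

theorem move_elt_upper (a : Letter n m) {y : ℝ} (hy : y ≤ cutPt n k a.exc) :
    move hk hm a.elt y ≤ cutPt n k (a.tgt + 1) + (a.shift 0 : ℤ) := by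
  have := (pingPong_line (n := n) hk hm).upper a 0 y (by simpa using hy)
  simpa using this

/-- The half-open block of the line with index `q`. -/
def InBlock (n k q : ℕ) (y : ℝ) : Prop := cutPt n k q < y ∧ y ≤ cutPt n k (q + 1)

/-- The part of the line between the end of a block with index `q` and the next such block. -/
def OffBlock (n k q : ℕ) (y : ℝ) : Prop := cutPt n k (q + 1) - 1 < y ∧ y ≤ cutPt n k q

theorem InBlock.offBlock {p q : ℕ} {y : ℝ} (h : InBlock n k p y) (hpq : p < q)
    (hq : q < k + 4 * n) : OffBlock n k q y := by
  have h1 := cutPt_lt_one (n := n) (k := k) (q := q + 1) (by omega)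
  have h2 := cutPt_nonneg (n := n) (k := k) p
  exact ⟨by linarith [h.1], h.2.trans (cutPt_strictMono.monotone (by omega))⟩

theorem move_zElt_mul (g : ExtGroup n k m) (x : ℝ) :
    move hk hm (zElt n k m * g) x = move hk hm g x + 1 := by
  have := move_zpow_mul hk hm g 1 x
  simpa using this

/-- Consecutive cut elements are linked by ping-pong letters, so a point outside the first block is
driven through all blocks from left to right. -/
theorem inBlock_cutElt {y : ℝ} (h0 : OffBlock n k 0 y) {q : ℕ} (hq : q < k + 4 * n) :
    InBlock n k q (move hk hm (cutElt n m (q + 1)) y) := by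
  have he : ∀ q < k, InBlock n k q (move hk hm (cutElt n m (q + 1)) y) := by
    intro q hq
    induction q with
    | zero =>
      have h1 := hm ⟨0, hq⟩
      have h2 := move_elt_lower (n := n) hk hm (.inl ⟨⟨0, hq⟩, ⟨m ⟨0, hq⟩ - 2, by omega⟩⟩) h0.1
      have h3 := move_elt_upper (n := n) hk hm (.inl ⟨⟨0, hq⟩, ⟨m ⟨0, hq⟩ - 2, by omega⟩⟩) h0.2
      have h4 : m ⟨0, hq⟩ - 2 + 1 = m ⟨0, hq⟩ - 1 := by omega
      simp only [elt, tgt, Letter.shift, Pi.zero_apply, mul_zero, Int.cast_zero, add_zero,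
        h4] at h2 h3
      rw [cutElt_succ_fin ⟨0, hq⟩, cutElt, mul_one]
      exact ⟨h2, h3⟩
    | succ q ih =>
      have h0 := (ih (by omega)).offBlock (q := q + 1) (by omega) (by omega)
      have h1 := hm ⟨q + 1, hq⟩
      have h2 := move_elt_lower (n := n) hk hm
        (.inl ⟨⟨q + 1, hq⟩, ⟨m ⟨q + 1, hq⟩ - 2, by omega⟩⟩) h0.1
      have h3 := move_elt_upper (n := n) hk hm
        (.inl ⟨⟨q + 1, hq⟩, ⟨m ⟨q + 1, hq⟩ - 2, by omega⟩⟩) h0.2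
      have h4 : m ⟨q + 1, hq⟩ - 2 + 1 = m ⟨q + 1, hq⟩ - 1 := by omega
      simp only [elt, tgt, Letter.shift, Pi.zero_apply, mul_zero, Int.cast_zero, add_zero,
        h4] at h2 h3
      rw [cutElt_succ_fin ⟨q + 1, hq⟩, move_mul]
      exact ⟨h2, h3⟩
  have hpair : ∀ p < n, InBlock n k (k + 4 * p - 1) (move hk hm (cutElt n m (k + 4 * p)) y) →
      ∀ r < 4, InBlock n k (k + 4 * p + r) (move hk hm (cutElt n m (k + 4 * p + r + 1)) y) := by
    intro p hp hB
    have e1 : 2 * p / 2 = p := by omega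
    have e2 : 2 * p % 2 = 0 := by omega
    have e3 : (2 * p + 1) / 2 = p := by omega
    have e4 : (2 * p + 1) % 2 = 1 := by omega
    -- The four blocks are treated in the order third, second, first, fourth: up to `z`, each new
    -- cut element is then a single letter times one already placed.
    have h3 : InBlock n k (k + 4 * p + 2) (move hk hm (cutElt n m (k + 4 * p + 3)) y) := by
      have h0 := hB.offBlock (q := k + 4 * p) (by omega) (by omega)
      have l := move_elt_lower (n := n) (m := m) hk hm (.inr (⟨2 * p, by omega⟩, false))
        (y := move hk hm (cutElt n m (k + 4 * p)) y) (by
          simpa only [exc, e1, e2, add_zero] using h0.1)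
      have u := move_elt_upper (n := n) (m := m) hk hm (.inr (⟨2 * p, by omega⟩, false))
        (y := move hk hm (cutElt n m (k + 4 * p)) y) (by
          simpa only [exc, e1, e2, add_zero] using h0.2)
      simp only [elt, tgt, Letter.shift, e1, e2, add_zero] at l u
      push_cast at l u
      rw [← move_mul] at l u
      have hc : cutElt n m (k + 4 * p + 3) =
          zElt n k m * ((hElt m ⟨2 * p, by omega⟩)⁻¹ * cutElt n m (k + 4 * p)) := by
        rw [← mul_assoc, (zElt_commute _).eq, mul_assoc, ← hElt_even_mul_lower hp,
          inv_mul_cancel_left]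
      rw [hc, move_zElt_mul]
      exact ⟨by linarith, by linarith⟩
    have h2 : InBlock n k (k + 4 * p + 1) (move hk hm (cutElt n m (k + 4 * p + 2)) y) := by
      have h0 := h3.offBlock (q := k + 4 * p + 3) (by omega) (by omega)
      have l := move_elt_lower (n := n) (m := m) hk hm (.inr (⟨2 * p + 1, by omega⟩, true))
        (y := move hk hm (cutElt n m (k + 4 * p + 3)) y) (by simpa only [exc, e3, e4] using h0.1)
      have u := move_elt_upper (n := n) (m := m) hk hm (.inr (⟨2 * p + 1, by omega⟩, true))
        (y := move hk hm (cutElt n m (k + 4 * p + 3)) y) (by simpa only [exc, e3, e4] using h0.2)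
      simp only [elt, tgt, Letter.shift, e3, e4, Int.cast_zero, add_zero] at l u
      rw [← move_mul, hElt_odd_mul_upper hp] at l u
      exact ⟨l, u⟩
    have h1 : InBlock n k (k + 4 * p) (move hk hm (cutElt n m (k + 4 * p + 1)) y) := by
      have h0 := h2.offBlock (q := k + 4 * p + 2) (by omega) (by omega)
      have l := move_elt_lower (n := n) (m := m) hk hm (.inr (⟨2 * p, by omega⟩, true))
        (y := move hk hm (cutElt n m (k + 4 * p + 2)) y) (by
          simpa only [exc, e1, e2, add_zero] using h0.1)
      have u := move_elt_upper (n := n) (m := m) hk hm (.inr (⟨2 * p, by omega⟩, true))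
        (y := move hk hm (cutElt n m (k + 4 * p + 2)) y) (by
          simpa only [exc, e1, e2, add_zero] using h0.2)
      simp only [elt, tgt, Letter.shift, e1, e2, Int.cast_zero, add_zero] at l u
      rw [← move_mul, hElt_even_mul_upper hp] at l u
      exact ⟨l, u⟩
    have h4 : InBlock n k (k + 4 * p + 3) (move hk hm (cutElt n m (k + 4 * p + 4)) y) := by
      have h0 := h1.offBlock (q := k + 4 * p + 1) (by omega) (by omega)
      have l := move_elt_lower (n := n) (m := m) hk hm (.inr (⟨2 * p + 1, by omega⟩, false))
        (y := move hk hm (cutElt n m (k + 4 * p + 1)) y) (by simpa only [exc, e3, e4] using h0.1)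
      have u := move_elt_upper (n := n) (m := m) hk hm (.inr (⟨2 * p + 1, by omega⟩, false))
        (y := move hk hm (cutElt n m (k + 4 * p + 1)) y) (by simpa only [exc, e3, e4] using h0.2)
      simp only [elt, tgt, Letter.shift, e3, e4] at l u
      push_cast at l u
      rw [← move_mul] at l u
      have hc : cutElt n m (k + 4 * p + 4) =
          zElt n k m * ((hElt m ⟨2 * p + 1, by omega⟩)⁻¹ * cutElt n m (k + 4 * p + 1)) := by
        rw [← mul_assoc, (zElt_commute _).eq, mul_assoc, ← hElt_odd_mul_lower hp,
          inv_mul_cancel_left]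
      rw [hc, move_zElt_mul]
      exact ⟨by linarith, by linarith⟩
    intro r hr
    interval_cases r
    exacts [h1, h2, h3, h4]
  have hbase : ∀ p < n, InBlock n k (k + 4 * p - 1) (move hk hm (cutElt n m (k + 4 * p)) y) := by
    intro p hp
    induction p with
    | zero =>
      have := he (k - 1) (by omega)
      rwa [Nat.sub_add_cancel hk] at this
    | succ p ih => exact hpair p (by omega) (ih (by omega)) 3 (by omega)
  by_cases hqk : q < k
  · exact he q hqk
  · have := hpair ((q - k) / 4) (by omega) (hbase _ (by omega)) ((q - k) % 4) (by omega)
    rwa [show k + 4 * ((q - k) / 4) + (q - k) % 4 = q by omega] at this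

/-- The images of `0` under the powers of the cusp element. -/
theorem move_cuspElt_pow_mem (hK : 2 ≤ k + 4 * n) (j : ℕ) :
    OffBlock n k 0 (move hk hm (cuspElt n m ^ j) 0) ∧
      (0 < j → move hk hm (cuspElt n m ^ j) 0 ≤ cutPt n k (k + 4 * n) - 1) := by
  induction j with
  | zero =>
    refine ⟨⟨?_, ?_⟩, fun h => absurd h (lt_irrefl 0)⟩
    · have := cutPt_one_lt (n := n) hk
      simpa using this
    · simp [cutPt_zero]
  | succ j ih =>
    -- `cuspElt` maps into the last block one sheet down. Having at least two blocks, this is again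
    -- outside the first block, and the induction continues.
    have h1 := inBlock_cutElt hk hm ih.1 (q := k + 4 * n - 1) (by omega)
    rw [Nat.sub_add_cancel (by omega)] at h1
    have h2 : move hk hm (cuspElt n m ^ (j + 1)) 0 =
        move hk hm (cutElt n m (k + 4 * n)) (move hk hm (cuspElt n m ^ j) 0) - 1 := by
      have := move_mul_zpow hk hm (cutElt n m (k + 4 * n)) (-1) (move hk hm (cuspElt n m ^ j) 0)
      rw [zpow_neg_one, ← cuspElt] at this
      rw [pow_succ', move_mul, this]
      push_cast
      ring
    obtain ⟨h3, h4⟩ := h1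
    rw [Nat.sub_add_cancel (by omega)] at h4
    have h5 := cutPt_strictMono.monotone (show 1 ≤ k + 4 * n - 1 by omega) (α := ℕ)
      (f := cutPt n k)
    have h6 := cutPt_lt_one (n := n) (k := k) le_rfl
    rw [h2]
    refine ⟨⟨by rw [zero_add]; linarith, by rw [cutPt_zero]; linarith⟩, fun _ => by linarith⟩

end line

/-! ### The degree homomorphism and the Euler characteristic -/

section degree

/-- The degree homomorphism, additively: `z ↦ M`, `eᵢ ↦ M / mᵢ`, `hⱼ ↦ 0` for `M = ∏ mᵢ`. -/
def degHom (n : ℕ) (m : Fin k → ℕ) : ExtGroup n k m →* Multiplicative ℤ :=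
  lift (fun i => .ofAdd ((∏ i' ∈ Finset.univ.erase i, m i' : ℕ) : ℤ)) 1
    (.ofAdd ((∏ i, m i : ℕ) : ℤ))
    (fun i => by
      rw [← ofAdd_nsmul, nsmul_eq_mul, ← Nat.cast_mul,
        Finset.mul_prod_erase _ _ (Finset.mem_univ i)])
    (fun _ => Commute.one_left _)

/-- The degree of an element. -/
def deg (g : ExtGroup n k m) : ℤ := (degHom n m g).toAdd

theorem deg_mul (g h : ExtGroup n k m) : deg (g * h) = deg g + deg h := by
  rw [deg, map_mul, toAdd_mul, deg, deg]

theorem deg_one : deg (1 : ExtGroup n k m) = 0 := by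
  rw [deg, map_one, toAdd_one]

theorem deg_inv (g : ExtGroup n k m) : deg g⁻¹ = - deg g := by
  rw [deg, map_inv, toAdd_inv, deg]

theorem deg_pow (g : ExtGroup n k m) (r : ℕ) : deg (g ^ r) = r * deg g := by
  rw [deg, map_pow, toAdd_pow, deg, nsmul_eq_mul]

theorem deg_zpow (g : ExtGroup n k m) (r : ℤ) : deg (g ^ r) = r * deg g := by
  rw [deg, map_zpow, toAdd_zpow, deg, smul_eq_mul]

theorem deg_zElt : deg (zElt n k m) = (∏ i, m i : ℕ) := by
  rw [deg, degHom, lift_zElt, toAdd_ofAdd]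

theorem deg_hElt (j : Fin (2 * n)) : deg (hElt m j) = 0 := by
  rw [deg, degHom, lift_hElt, Pi.one_apply, toAdd_one]

theorem mul_deg_eElt (i : Fin k) : m i * deg (eElt n m i) = (∏ i, m i : ℕ) := by
  rw [← deg_zElt (n := n), ← eElt_pow i, deg_pow]

theorem deg_cutElt_fin (hm : ∀ i, 2 ≤ m i) (q : ℕ) (hq : q ≤ k) : deg (cutElt n m q) =
    ∑ i : Fin q, ((∏ i, m i : ℕ) - deg (eElt n m (Fin.castLE hq i))) := by
  induction q with
  | zero => simp [cutElt, deg_one]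
  | succ q ih =>
    rw [cutElt_succ_fin ⟨q, hq⟩, deg_mul, ih (by omega), Fin.sum_univ_castSucc, add_comm]
    congr 1
    have h := hm ⟨q, hq⟩
    rw [deg_pow, ← mul_deg_eElt (n := n) ⟨q, hq⟩, Nat.cast_sub (by omega), Nat.cast_one,
      show Fin.castLE hq (Fin.last q) = ⟨q, hq⟩ from rfl]
    ring

theorem deg_cutElt_pair (p : ℕ) (hp : p ≤ n) : deg (cutElt n m (k + 4 * p)) =
    deg (cutElt n m k) + 2 * p * (∏ i, m i : ℕ) := by
  induction p with
  | zero => simp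
  | succ p ih =>
    rw [show k + 4 * (p + 1) = k + 4 * p + 4 by ring, cutElt_pair_four (by omega),
      cutElt_pair_three (by omega), cutElt_pair_two (by omega), cutElt_pair_one (by omega)]
    simp only [deg_mul, deg_inv, deg_hElt, deg_zElt]
    rw [ih (by omega)]
    push_cast
    ring

end degree

end ExtGroup

namespace ExtGroup

open Letter

variable {n k : ℕ} {m : Fin k → ℕ}

theorem deg_cuspElt (hm : ∀ i, 2 ≤ m i) : deg (cuspElt n m) =
    ∑ i, ((∏ i, m i : ℕ) - deg (eElt n m i)) + 2 * n * (∏ i, m i : ℕ) - (∏ i, m i : ℕ) := by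
  rw [cuspElt, deg_mul, deg_inv, deg_zElt, deg_cutElt_pair n le_rfl, deg_cutElt_fin hm k le_rfl]
  simp only [Fin.castLE_rfl, id]
  ring

/-- Divided by `∏ mᵢ`, the degree is `∑ (1 - 1 / mᵢ) + 2n - 1`, minus the orbifold Euler
characteristic. Each cone point contributes at least `1 / 2`, so only genus `0` with at most two
cone points needs care. -/
theorem deg_cuspElt_pos (hk : 1 ≤ k) (hm : ∀ i, 2 ≤ m i) (h₁ : ¬ (n = 0 ∧ k = 1))
    (h₂ : ¬ (n = 0 ∧ k = 2 ∧ ∀ i, m i = 2)) : 0 < deg (cuspElt n m) := by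
  rw [deg_cuspElt hm]
  have hM : (0 : ℤ) < (∏ i, m i : ℕ) := by
    have : 0 < ∏ i, m i := Finset.prod_pos fun i _ => by have := hm i; omega
    exact_mod_cast this
  set M : ℤ := ((∏ i, m i : ℕ) : ℤ) with hMdef
  have hmul : ∀ i, m i * deg (eElt n m i) = M := mul_deg_eElt
  have hpos : ∀ i, 0 < deg (eElt n m i) := fun i => by
    have h1 := hmul i
    have h2 := hm i
    by_contra! h
    nlinarith
  have hhalf : ∀ i, M ≤ 2 * (M - deg (eElt n m i)) := fun i => by
    have h1 := hmul i
    have h2 : (2 : ℤ) ≤ m i := by exact_mod_cast hm i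
    nlinarith [hpos i]
  have hsum : k * M ≤ 2 * ∑ i, (M - deg (eElt n m i)) := by
    rw [Finset.mul_sum]
    calc k * M = ∑ _i : Fin k, M := by simp
      _ ≤ _ := Finset.sum_le_sum fun i _ => hhalf i
  have hk' : (1 : ℤ) ≤ k := by exact_mod_cast hk
  rcases Nat.eq_zero_or_pos n with rfl | hn
  · rcases (show k = 2 ∨ 3 ≤ k by omega) with rfl | hk3
    · have hlt : ∀ i, m i ≠ 2 → M < 2 * (M - deg (eElt 0 m i)) := fun i hi => by
        have h1 := hmul i
        have h2 : (3 : ℤ) ≤ m i := by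
          have := hm i
          exact_mod_cast (by omega : 3 ≤ m i)
        nlinarith [hpos i]
      have hex : ∃ i, m i ≠ 2 := by
        by_contra! h
        exact h₂ ⟨rfl, rfl, h⟩
      have hlast : ∑ _i : Fin 2, M < ∑ i : Fin 2, 2 * (M - deg (eElt 0 m i)) := by
        obtain ⟨i, hi⟩ := hex
        exact Finset.sum_lt_sum (fun i _ => hhalf i) ⟨i, Finset.mem_univ i, hlt i hi⟩
      rw [← Finset.mul_sum] at hlast
      simp only [Finset.sum_const, Finset.card_univ, Fintype.card_fin, nsmul_eq_mul] at hlast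
      push_cast at hlast ⊢
      linarith
    · have : (3 : ℤ) ≤ k := by exact_mod_cast hk3
      push_cast
      nlinarith
  · have : (1 : ℤ) ≤ n := by exact_mod_cast hn
    nlinarith

/-! ### Coverings, their endomorphisms and the lifted cuts -/

/-- The data of a cyclic covering of degree `D` of the circle to which the action lifts. -/
structure Cover (n : ℕ) (m : Fin k → ℕ) where
  D : ℕ
  δ : Fin k → ℤ
  pos : 0 < D
  eq_add : ∀ i, (D : ℤ) = 1 + m i * δ i
  coprime_z : IsCoprime (D : ℤ) (deg (zElt n k m))
  coprime_cusp : IsCoprime (D : ℤ) (deg (cuspElt n m))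

namespace Cover

variable (Δ : Cover n m)

/-- The endomorphism `eᵢ ↦ eᵢ ^ D`, `hⱼ ↦ hⱼ`, `z ↦ z ^ D`. -/
def hom : ExtGroup n k m →* ExtGroup n k m :=
  lift (fun i => eElt n m i * zElt n k m ^ Δ.δ i) (hElt m) (zElt n k m ^ (Δ.D : ℤ))
    (fun i => by
      rw [(zElt_zpow_commute _ _).symm.mul_pow, eElt_pow, ← zpow_natCast, ← zpow_mul, Δ.eq_add i,
        zpow_add, zpow_one, mul_comm (m i : ℤ)])
    (fun j => (hElt_commute j).zpow_right _)

theorem hom_eElt (i : Fin k) : Δ.hom (eElt n m i) = eElt n m i * zElt n k m ^ Δ.δ i := lift_eElt i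

theorem hom_hElt (j : Fin (2 * n)) : Δ.hom (hElt m j) = hElt m j := lift_hElt j

theorem hom_zElt : Δ.hom (zElt n k m) = zElt n k m ^ (Δ.D : ℤ) := lift_zElt

theorem hom_zpow (s : ℤ) : Δ.hom (zElt n k m ^ s) = zElt n k m ^ (Δ.D * s : ℤ) := by
  rw [map_zpow, hom_zElt, zpow_mul]

theorem hom_eq_mul (g : ExtGroup n k m) : ∃ s : ℤ, Δ.hom g = g * zElt n k m ^ s := by
  let S : Subgroup (ExtGroup n k m) :=
    { carrier := {g | ∃ s : ℤ, Δ.hom g = g * zElt n k m ^ s}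
      one_mem' := ⟨0, by simp⟩
      mul_mem' := by
        rintro a b ⟨s, hs⟩ ⟨t, ht⟩
        refine ⟨s + t, ?_⟩
        rw [map_mul, hs, ht, mul_assoc, ← mul_assoc (zElt n k m ^ s), (zElt_zpow_commute s b).eq,
          zpow_add, mul_assoc, mul_assoc]
      inv_mem' := by
        rintro a ⟨s, hs⟩
        refine ⟨-s, ?_⟩
        rw [map_inv, hs, mul_inv_rev, zpow_neg, ← zpow_neg, (zElt_zpow_commute _ _).eq] }
  refine mem_of_generators S (fun i => ⟨_, Δ.hom_eElt i⟩) (fun j => ⟨0, ?_⟩) ⟨Δ.D - 1, ?_⟩ g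
  · rw [Δ.hom_hElt, zpow_zero, mul_one]
  · rw [Δ.hom_zElt, ← zpow_one_add]
    congr 1
    ring

theorem deg_hom (g : ExtGroup n k m) : deg (Δ.hom g) = Δ.D * deg g := by
  let S : Subgroup (ExtGroup n k m) :=
    { carrier := {g | deg (Δ.hom g) = Δ.D * deg g}
      one_mem' := by simp [deg_one]
      mul_mem' := by
        intro a b ha hb
        simp only [Set.mem_ofPred_eq] at *
        rw [map_mul, deg_mul, deg_mul, ha, hb, mul_add]
      inv_mem' := by
        intro a ha
        simp only [Set.mem_ofPred_eq] at *
        rw [map_inv, deg_inv, deg_inv, ha, mul_neg] }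
  refine mem_of_generators S (fun i => ?_) (fun j => ?_) ?_ g
  · change deg (Δ.hom (eElt n m i)) = Δ.D * deg (eElt n m i)
    rw [Δ.hom_eElt, deg_mul, deg_zpow, deg_zElt, ← mul_deg_eElt (n := n) i, Δ.eq_add i]
    ring
  · change deg (Δ.hom (hElt m j)) = Δ.D * deg (hElt m j)
    rw [Δ.hom_hElt, deg_hElt, mul_zero]
  · change deg (Δ.hom (zElt n k m)) = Δ.D * deg (zElt n k m)
    rw [Δ.hom_zElt, deg_zpow]

/-- Since `hom` changes elements only by powers of `z`, its kernel lies in `⟨z⟩`, where it is the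
`D`-th power map on an infinite cyclic group. -/
theorem hom_injective (hk : 1 ≤ k) (hm : ∀ i, 2 ≤ m i) : Function.Injective Δ.hom := by
  rw [injective_iff_map_eq_one]
  intro g hg
  obtain ⟨s, hs⟩ := Δ.hom_eq_mul g
  rw [hg] at hs
  obtain rfl : g = zElt n k m ^ (-s) := by
    rw [zpow_neg]
    exact eq_inv_of_mul_eq_one_left hs.symm
  rw [hom_zpow, ← zpow_zero (zElt n k m)] at hg
  have h := zElt_zpow_injective hk hm hg
  have hD := Δ.pos
  rcases mul_eq_zero.1 h with h | h
  · omega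
  · rw [h, zpow_zero]

/-- Write `hom g = g * z ^ s`. Degrees give `D ∣ s * deg z`, so `D ∣ s` by `coprime_z`, and the
error is itself the image of a power of `z`. -/
theorem exists_hom_eq {g : ExtGroup n k m} (hg : (Δ.D : ℤ) ∣ deg g) : ∃ g', Δ.hom g' = g := by
  obtain ⟨s, hs⟩ := Δ.hom_eq_mul g
  have h1 := Δ.deg_hom g
  rw [hs, deg_mul, deg_zpow] at h1
  have h2 : (Δ.D : ℤ) ∣ s := by
    refine Δ.coprime_z.dvd_of_dvd_mul_right ?_
    rw [show s * deg (zElt n k m) = Δ.D * deg g - deg g by linarith]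
    exact dvd_sub (dvd_mul_right _ _) hg
  obtain ⟨t, rfl⟩ := h2
  refine ⟨g * zElt n k m ^ (-t), ?_⟩
  rw [map_mul, hs, hom_zpow, mul_assoc, ← zpow_add, mul_neg, add_neg_cancel, zpow_zero, mul_one]

/-- The degree of `cuspElt` is invertible modulo `D`, so exactly one exponent modulo `D` corrects a
given degree to a multiple of `D`. -/
theorem exists_cusp_index (d : ℤ) : ∃ j : ℕ, j < Δ.D ∧
    (Δ.D : ℤ) ∣ d + j * deg (cuspElt n m) := by
  obtain ⟨a, b, hab⟩ := Δ.coprime_cusp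
  have hD : (0 : ℤ) < Δ.D := by exact_mod_cast Δ.pos
  obtain ⟨j, hj⟩ := Int.eq_ofNat_of_zero_le (Int.emod_nonneg (-(d * b)) hD.ne')
  refine ⟨j, by have := Int.emod_lt_of_pos (-(d * b)) hD; omega, ?_⟩
  have h1 : (j : ℤ) = -(d * b) - Δ.D * (-(d * b) / Δ.D) := by
    rw [← hj, Int.emod_def]
  refine ⟨d * a - -(d * b) / Δ.D * deg (cuspElt n m), ?_⟩
  rw [h1]
  linear_combination -d * hab

theorem cusp_index_unique {d : ℤ} {i j : ℕ} (hi : i < Δ.D) (hj : j < Δ.D)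
    (hi' : (Δ.D : ℤ) ∣ d + i * deg (cuspElt n m)) (hj' : (Δ.D : ℤ) ∣ d + j * deg (cuspElt n m)) :
    i = j := by
  have h : (Δ.D : ℤ) ∣ (i : ℤ) - j := by
    refine Δ.coprime_cusp.dvd_of_dvd_mul_right ?_
    convert dvd_sub hi' hj' using 1
    ring
  have := Int.eq_zero_of_abs_lt_dvd h (by rw [abs_lt]; omega)
  omega

/-- The power of the cusp element needed to get into the image of `hom`. -/
noncomputable def cuspIndex (s : ℤ) (q : ℕ) : ℕ :=
  (Δ.exists_cusp_index (deg (zElt n k m ^ s * cutElt n m q))).choose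

theorem cuspIndex_lt (s : ℤ) (q : ℕ) : Δ.cuspIndex s q < Δ.D :=
  (Δ.exists_cusp_index (deg (zElt n k m ^ s * cutElt n m q))).choose_spec.1

theorem dvd_cuspIndex (s : ℤ) (q : ℕ) : (Δ.D : ℤ) ∣
    deg (zElt n k m ^ s * cutElt n m q) + Δ.cuspIndex s q * deg (cuspElt n m) :=
  (Δ.exists_cusp_index (deg (zElt n k m ^ s * cutElt n m q))).choose_spec.2

theorem cuspIndex_eq {s : ℤ} {q j : ℕ} (hj : j < Δ.D)
    (h : (Δ.D : ℤ) ∣ deg (zElt n k m ^ s * cutElt n m q * cuspElt n m ^ j)) :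
    Δ.cuspIndex s q = j := by
  rw [deg_mul, deg_pow] at h
  exact Δ.cusp_index_unique (Δ.cuspIndex_lt s q) hj (Δ.dvd_cuspIndex s q) h

theorem exists_cut (s : ℤ) (q : ℕ) : ∃ g, Δ.hom g =
    zElt n k m ^ s * cutElt n m q * cuspElt n m ^ Δ.cuspIndex s q := by
  refine Δ.exists_hom_eq ?_
  rw [deg_mul, deg_pow]
  exact Δ.dvd_cuspIndex s q

/-- The end points of the blocks in the covering. -/
noncomputable def cut (s : ℤ) (q : ℕ) : ExtGroup n k m := (Δ.exists_cut s q).choose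

theorem hom_cut (s : ℤ) (q : ℕ) : Δ.hom (Δ.cut s q) =
    zElt n k m ^ s * cutElt n m q * cuspElt n m ^ Δ.cuspIndex s q :=
  (Δ.exists_cut s q).choose_spec

/-- If the image of `g` has the right form, then the exponent is the right one. -/
theorem cuspIndex_eq_of_hom {g : ExtGroup n k m} {s : ℤ} {q j : ℕ} (hj : j < Δ.D)
    (h : Δ.hom g = zElt n k m ^ s * cutElt n m q * cuspElt n m ^ j) : Δ.cuspIndex s q = j := by
  refine Δ.cuspIndex_eq hj ?_
  rw [← h, deg_hom]
  exact dvd_mul_right _ _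

theorem eq_cut_of_hom (hk : 1 ≤ k) (hm : ∀ i, 2 ≤ m i) {g : ExtGroup n k m} {s : ℤ} {q j : ℕ}
    (hj : j < Δ.D) (h : Δ.hom g = zElt n k m ^ s * cutElt n m q * cuspElt n m ^ j) :
    g = Δ.cut s q := by
  apply Δ.hom_injective hk hm
  rw [hom_cut, Δ.cuspIndex_eq_of_hom hj h, h]

theorem cut_zero_zero (hk : 1 ≤ k) (hm : ∀ i, 2 ≤ m i) : Δ.cut 0 0 = 1 :=
  (Δ.eq_cut_of_hom hk hm Δ.pos (by simp [cutElt])).symm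

theorem cut_add_mul (hk : 1 ≤ k) (hm : ∀ i, 2 ≤ m i) (s r : ℤ) (q : ℕ) :
    Δ.cut (s + Δ.D * r) q = zElt n k m ^ r * Δ.cut s q := by
  refine (Δ.eq_cut_of_hom hk hm (Δ.cuspIndex_lt s q) ?_).symm
  rw [map_mul, hom_zpow, hom_cut, zpow_add, ← mul_assoc, ← mul_assoc,
    (zElt_zpow_commute _ (zElt n k m ^ s)).eq]

/-- The cut in front of the gap is one step before the cut after the gap, unless the point of the
gap is present in the covering. -/
theorem cut_last (hk : 1 ≤ k) (hm : ∀ i, 2 ≤ m i) (s : ℤ) :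
    (0 < Δ.cuspIndex (s + 1) 0 ∧ Δ.cut s (k + 4 * n) = Δ.cut (s + 1) 0) ∨
      (Δ.cuspIndex (s + 1) 0 = 0 ∧
        Δ.hom (Δ.cut s (k + 4 * n)) = zElt n k m ^ (s + 1) * cuspElt n m ^ Δ.D) := by
  have h : Δ.hom (Δ.cut s (k + 4 * n)) =
      zElt n k m ^ (s + 1) * cuspElt n m ^ (Δ.cuspIndex s (k + 4 * n) + 1) := by
    have hc : cutElt n m (k + 4 * n) = zElt n k m * cuspElt n m := by
      rw [(zElt_commute _).eq, cuspElt, inv_mul_cancel_right]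
    rw [hom_cut, hc, pow_succ', zpow_add, zpow_one]
    group
  have hlt := Δ.cuspIndex_lt s (k + 4 * n)
  -- Crossing the gap costs one factor `cuspElt`. If the raised exponent is still below `D`, it is
  -- the index of the next cut and the gap closes; if it reaches `D`, the next index is `0` and the
  -- gap survives.
  rcases (show Δ.cuspIndex s (k + 4 * n) + 1 < Δ.D ∨ Δ.cuspIndex s (k + 4 * n) + 1 = Δ.D by omega)
    with h1 | h1
  · have h2 : Δ.hom (Δ.cut s (k + 4 * n)) = zElt n k m ^ (s + 1) * cutElt n m 0 *
        cuspElt n m ^ (Δ.cuspIndex s (k + 4 * n) + 1) := by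
      rw [h, cutElt, mul_one]
    exact .inl ⟨by rw [Δ.cuspIndex_eq_of_hom h1 h2]; omega, Δ.eq_cut_of_hom hk hm h1 h2⟩
  · rw [h1] at h
    refine .inr ⟨Δ.cuspIndex_eq Δ.pos ?_, h⟩
    have h2 := congrArg deg h
    rw [deg_hom, deg_mul, deg_pow] at h2
    rw [cutElt, mul_one, pow_zero, mul_one,
      show deg (zElt n k m ^ (s + 1)) = Δ.D * deg (Δ.cut s (k + 4 * n)) -
        Δ.D * deg (cuspElt n m) by linarith]
    exact dvd_sub (dvd_mul_right _ _) (dvd_mul_right _ _)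

theorem hom_cut_neg_one (hk : 1 ≤ k) (hm : ∀ i, 2 ≤ m i) :
    Δ.hom (Δ.cut (-1) (k + 4 * n)) = cuspElt n m ^ Δ.D := by
  rcases Δ.cut_last hk hm (-1) with h | h
  · have h0 : Δ.cuspIndex 0 0 = 0 := Δ.cuspIndex_eq Δ.pos (by simp [cutElt, deg_one])
    rw [neg_add_cancel, h0] at h
    exact absurd h.1 (lt_irrefl 0)
  · simpa using h.2

end Cover

end ExtGroup

/-! ### The order of a covering and its defining inequalities -/

namespace ExtGroup

open Letter

variable {n k : ℕ} {m : Fin k → ℕ}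

section line

variable (hk : 1 ≤ k) (hm : ∀ i, 2 ≤ m i)

theorem offBlock_cutElt (hK : 2 ≤ k + 4 * n) (j : ℕ) {q : ℕ} (hq : q < k + 4 * n) :
    OffBlock n k q (move hk hm (cutElt n m q * cuspElt n m ^ j) 0) := by
  rw [move_mul]
  rcases q with - | q
  · rw [cutElt, move_one]
    exact (move_cuspElt_pow_mem hk hm hK j).1
  · exact (inBlock_cutElt hk hm (move_cuspElt_pow_mem hk hm hK j).1 (by omega)).offBlock
      (by omega) hq

theorem cutPt_lt_move (hK : 2 ≤ k + 4 * n) (j : ℕ) {q : ℕ} (hq : q < k + 4 * n) :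
    cutPt n k q < move hk hm (cutElt n m (q + 1) * cuspElt n m ^ j) 0 := by
  rw [move_mul]
  exact (inBlock_cutElt hk hm (move_cuspElt_pow_mem hk hm hK j).1 hq).1

end line

namespace Cover

variable (Δ : Cover n m) (hk : 1 ≤ k) (hm : ∀ i, 2 ≤ m i)

/-- The left order given by the lift of the action to the covering. -/
noncomputable def order : LeftOrder (ExtGroup n k m) :=
  LeftOrder.ofFreeOrbit (fun g => move hk hm (Δ.hom g) 0)
    (fun a b h => by
      apply Δ.hom_injective hk hm
      rw [← inv_mul_eq_one]
      refine eq_one_of_move_zero hk hm ?_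
      dsimp only at h
      rw [move_mul, ← h, ← move_mul, inv_mul_cancel, move_one])
    (fun g a b h => by
      rw [map_mul, map_mul, move_mul, move_mul]
      exact move_strictMono hk hm _ h)

theorem order_lt {a b : ExtGroup n k m} :
    (Δ.order hk hm).lt a b ↔ move hk hm (Δ.hom a) 0 < move hk hm (Δ.hom b) 0 := Iff.rfl

theorem order_le {a b : ExtGroup n k m} (h : move hk hm (Δ.hom a) 0 ≤ move hk hm (Δ.hom b) 0) :
    (Δ.order hk hm).le a b := by
  by_cases hab : a = b
  · exact .inr hab
  · refine .inl ((Δ.order_lt hk hm).2 (lt_of_le_of_ne h fun h' => hab ?_))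
    apply Δ.hom_injective hk hm
    rw [← inv_mul_eq_one]
    refine eq_one_of_move_zero hk hm ?_
    rw [move_mul, ← h', ← move_mul, inv_mul_cancel, move_one]

/-- The inequalities near the block `s` that a left order has to satisfy in order to be given by
ping-pong. -/
structure RigidAt (L : LeftOrder (ExtGroup n k m)) (s : ℤ) : Prop where
  mono : ∀ q : Fin (k + 4 * n), L.le (Δ.cut s q) (Δ.cut s (q + 1))
  wrap : L.le (Δ.cut s (k + 4 * n)) (Δ.cut (s + 1) 0)
  lower : ∀ a : Letter n m,
    L.le (Δ.cut (s + a.shift Δ.δ) a.tgt) (a.elt * Δ.cut (s - 1) (a.exc + 1))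
  upper : ∀ a : Letter n m,
    L.le (a.elt * Δ.cut s a.exc) (Δ.cut (s + a.shift Δ.δ) (a.tgt + 1))

theorem isOpen_setOf_rigidAt (s : ℤ) :
    IsOpen {L : LeftOrder (ExtGroup n k m) | Δ.RigidAt L s} := by
  have : {L : LeftOrder (ExtGroup n k m) | Δ.RigidAt L s} =
      (⋂ q : Fin (k + 4 * n), {L | L.le (Δ.cut s q) (Δ.cut s (q + 1))}) ∩
      ({L | L.le (Δ.cut s (k + 4 * n)) (Δ.cut (s + 1) 0)} ∩
      ((⋂ a : Letter n m,
        {L | L.le (Δ.cut (s + a.shift Δ.δ) a.tgt) (a.elt * Δ.cut (s - 1) (a.exc + 1))}) ∩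
      (⋂ a : Letter n m,
        {L | L.le (a.elt * Δ.cut s a.exc) (Δ.cut (s + a.shift Δ.δ) (a.tgt + 1))}))) := by
    ext L
    simp only [Set.mem_inter_iff, Set.mem_iInter, Set.mem_ofPred_eq]
    exact ⟨fun h => ⟨h.mono, h.wrap, h.lower, h.upper⟩, fun h => ⟨h.1, h.2.1, h.2.2.1, h.2.2.2⟩⟩
  rw [this]
  exact (isOpen_iInter_of_finite fun _ => LeftOrder.isOpen_setOf_le _ _).inter
    ((LeftOrder.isOpen_setOf_le _ _).inter
      ((isOpen_iInter_of_finite fun _ => LeftOrder.isOpen_setOf_le _ _).inter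
        (isOpen_iInter_of_finite fun _ => LeftOrder.isOpen_setOf_le _ _)))

theorem le_mul_left {L : LeftOrder (ExtGroup n k m)} {a b : ExtGroup n k m} (h : L.le a b)
    (g : ExtGroup n k m) : L.le (g * a) (g * b) :=
  h.imp (L.mul_left g a b) (congrArg _)

/-- Multiplication by the central `z ^ r` moves the cuts `D * r` sheets up, so the inequalities need
checking only for `s` modulo `D`. -/
theorem RigidAt.add_mul (hk : 1 ≤ k) (hm : ∀ i, 2 ≤ m i) {L : LeftOrder (ExtGroup n k m)} {s : ℤ}
    (h : Δ.RigidAt L s) (r : ℤ) : Δ.RigidAt L (s + Δ.D * r) where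
  mono q := by
    rw [Δ.cut_add_mul hk hm, Δ.cut_add_mul hk hm]
    exact le_mul_left (h.mono q) _
  wrap := by
    rw [add_right_comm, Δ.cut_add_mul hk hm, Δ.cut_add_mul hk hm]
    exact le_mul_left h.wrap _
  lower a := by
    rw [add_right_comm, add_sub_right_comm, Δ.cut_add_mul hk hm, Δ.cut_add_mul hk hm,
      ← mul_assoc, ← (zElt_zpow_commute r a.elt).eq, mul_assoc]
    exact le_mul_left (h.lower a) _
  upper a := by
    rw [add_right_comm, Δ.cut_add_mul hk hm, Δ.cut_add_mul hk hm,
      ← mul_assoc, ← (zElt_zpow_commute r a.elt).eq, mul_assoc]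
    exact le_mul_left (h.upper a) _

theorem move_hom_cut (s : ℤ) (q : ℕ) : move hk hm (Δ.hom (Δ.cut s q)) 0 =
    move hk hm (cutElt n m q * cuspElt n m ^ Δ.cuspIndex s q) 0 + s := by
  rw [hom_cut, mul_assoc, move_zpow_mul]

theorem hom_elt_inl (i : Fin k) (l : Fin (m i - 1)) :
    Δ.hom (elt (n := n) (.inl ⟨i, l⟩)) =
      eElt n m i ^ ((l : ℕ) + 1) * zElt n k m ^ (Letter.shift (n := n) Δ.δ (.inl ⟨i, l⟩)) := by
  rw [elt, map_pow, Δ.hom_eElt, (zElt_zpow_commute _ _).symm.mul_pow, Letter.shift, ← zpow_natCast,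
    ← zpow_natCast, ← zpow_mul, mul_comm]

theorem hom_elt_mul_cut (i : Fin k) (l : Fin (m i - 1)) (s : ℤ) (q : ℕ) :
    Δ.hom (elt (n := n) (.inl ⟨i, l⟩) * Δ.cut s q) =
      zElt n k m ^ (s + Letter.shift (n := n) Δ.δ (.inl ⟨i, l⟩)) *
        (eElt n m i ^ ((l : ℕ) + 1) * cutElt n m q * cuspElt n m ^ Δ.cuspIndex s q) := by
  rw [map_mul, hom_elt_inl, hom_cut, zpow_add]
  set S := Letter.shift (n := n) Δ.δ (.inl ⟨i, l⟩)
  set e := eElt n m i ^ ((l : ℕ) + 1)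
  rw [(zElt_zpow_commute s (zElt n k m ^ S)).eq, ← (zElt_zpow_commute S e).eq]
  rw [mul_assoc, ← mul_assoc e, ← mul_assoc e, ← (zElt_zpow_commute s e).eq]
  simp only [mul_assoc]

theorem hom_elt_mul_cut_succ (i : Fin k) (l : Fin (m i - 1)) (s : ℤ) :
    Δ.hom (elt (n := n) (.inl ⟨i, l⟩) * Δ.cut (s - 1) (i + 1)) =
      zElt n k m ^ (s + Letter.shift (n := n) Δ.δ (.inl ⟨i, l⟩)) *
        (eElt n m i ^ (l : ℕ) * cutElt n m i * cuspElt n m ^ Δ.cuspIndex (s - 1) (i + 1)) := by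
  have hl := l.2
  have h : eElt n m i ^ ((l : ℕ) + 1) * eElt n m i ^ (m i - 1) =
      zElt n k m ^ (1 : ℤ) * eElt n m i ^ (l : ℕ) := by
    rw [zpow_one, ← eElt_pow i, ← pow_add, ← pow_add]
    congr 1
    omega
  rw [hom_elt_mul_cut, cutElt_succ_fin, ← mul_assoc (eElt n m i ^ ((l : ℕ) + 1)), h, mul_assoc,
    mul_assoc, ← mul_assoc (zElt n k m ^ (s - 1 + _)), ← zpow_add,
    ← mul_assoc (eElt n m i ^ (l : ℕ))]
  congr 2
  ring

/-- For `hⱼ` and its inverse the letter conditions are equalities in the group, from the cut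
identities. For powers of `eᵢ` they are equalities at the extreme exponents; in between, the fixed
points `cutPt` separate the two sides. -/
theorem rigidAt_order (hK : 2 ≤ k + 4 * n) (s : ℤ) : Δ.RigidAt (Δ.order hk hm) s where
  mono q := by
    apply Δ.order_le hk hm
    rw [move_hom_cut, move_hom_cut]
    have h1 := offBlock_cutElt hk hm hK (Δ.cuspIndex s q) q.2
    have h2 := cutPt_lt_move hk hm hK (Δ.cuspIndex s (q + 1)) q.2
    linarith [h1.2]
  wrap := by
    rcases Δ.cut_last hk hm s with ⟨-, h⟩ | ⟨h, h'⟩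
    · exact .inr h
    · apply Δ.order_le hk hm
      rw [h', move_zpow_mul, move_hom_cut, h, cutElt, pow_zero, mul_one, move_one]
      have := (move_cuspElt_pow_mem hk hm hK Δ.D).1.2
      rw [cutPt_zero] at this
      linarith
  lower a := by
    rcases a with ⟨i, l⟩ | ⟨j, _ | _⟩
    · have hiK : (i : ℕ) < k + 4 * n := by omega
      simp only [tgt, exc]
      by_cases hl : (l : ℕ) = 0
      · refine .inr (Δ.eq_cut_of_hom hk hm (Δ.cuspIndex_lt (s - 1) (i + 1)) ?_).symm
        rw [hom_elt_mul_cut_succ, hl, pow_zero, one_mul, ← mul_assoc]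
      · apply Δ.order_le hk hm
        rw [hom_elt_mul_cut_succ, move_hom_cut, move_zpow_mul, mul_assoc,
          move_mul hk hm (eElt n m i ^ (l : ℕ))]
        have h1 := offBlock_cutElt hk hm hK
          (Δ.cuspIndex (s + Letter.shift (n := n) Δ.δ (.inl ⟨i, l⟩)) i) hiK
        have h2 := offBlock_cutElt hk hm hK (Δ.cuspIndex (s - 1) (i + 1)) hiK
        have h3 := move_elt_lower (n := n) hk hm (.inl ⟨i, ⟨l - 1, by omega⟩⟩) h2.1
        simp only [elt, tgt, Letter.shift, Pi.zero_apply, mul_zero, Int.cast_zero, add_zero,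
          show (l : ℕ) - 1 + 1 = l by omega] at h3
        linarith [h1.2]
    · refine .inr (Δ.eq_cut_of_hom hk hm (Δ.cuspIndex_lt (s - 1)
        (exc (m := m) (.inr (j, false)) + 1)) ?_).symm
      have h := hElt_mul_cutElt_upper (m := m) j
      rw [map_mul, hom_cut]
      simp only [elt, tgt, exc, Letter.shift] at h ⊢
      rw [map_inv, hom_hElt, ← h, ← sub_eq_add_neg, ← mul_assoc, ← mul_assoc,
        ← (zElt_zpow_commute (s - 1) (hElt m j)⁻¹).eq, mul_assoc (zElt n k m ^ (s - 1)),
        inv_mul_cancel_left]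
    · refine .inr (Δ.eq_cut_of_hom hk hm (Δ.cuspIndex_lt (s - 1)
        (exc (m := m) (.inr (j, true)) + 1)) ?_).symm
      have h := hElt_mul_cutElt_lower (m := m) j
      rw [map_mul, hom_cut]
      simp only [elt, tgt, exc, Letter.shift] at h ⊢
      rw [hom_hElt, add_zero, ← mul_assoc, ← mul_assoc,
        ← (zElt_zpow_commute (s - 1) (hElt m j)).eq, mul_assoc (zElt n k m ^ (s - 1)), h,
        ← mul_assoc, ← zpow_add_one, sub_add_cancel]
  upper a := by
    rcases a with ⟨i, l⟩ | ⟨j, _ | _⟩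
    · have hiK : (i : ℕ) < k + 4 * n := by omega
      have hl2 := l.2
      simp only [tgt, exc]
      by_cases hl : (l : ℕ) + 1 = m i - 1
      · refine .inr (Δ.eq_cut_of_hom hk hm (Δ.cuspIndex_lt s i) ?_)
        rw [hom_elt_mul_cut, hl, cutElt_succ_fin]
        simp only [mul_assoc]
      · apply Δ.order_le hk hm
        rw [hom_elt_mul_cut, move_hom_cut, move_zpow_mul, mul_assoc, move_mul, cutElt_succ_fin,
          mul_assoc, move_mul hk hm (eElt n m i ^ (m i - 1))]
        have h1 := offBlock_cutElt hk hm hK (Δ.cuspIndex s i) hiK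
        have h2 := offBlock_cutElt hk hm hK
          (Δ.cuspIndex (s + Letter.shift (n := n) Δ.δ (.inl ⟨i, l⟩)) (i + 1)) hiK
        have h3 := (move_strictMono hk hm (eElt n m i ^ ((l : ℕ) + 1))).monotone h1.2
        -- The bound passes through `eᵢ ^ (mᵢ - 2)` at `cutPt n k i`, which equals `eᵢ ^ (mᵢ - 1)`
        -- at `cutPt n k (i + 1) - 1`.
        have h4 := (move_eElt_pow_mono (n := n) hk hm i).monotone
          (show (l : ℕ) + 1 ≤ m i - 2 by omega)
        have h5 := move_strictMono hk hm (eElt n m i ^ (m i - 2 + 1)) h2.1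
        rw [move_eElt_pow_succ] at h5
        rw [show m i - 2 + 1 = m i - 1 by omega] at h5
        linarith
    · refine .inr (Δ.eq_cut_of_hom hk hm (Δ.cuspIndex_lt s (exc (m := m) (.inr (j, false)))) ?_)
      have h := hElt_mul_cutElt_lower (m := m) j
      rw [map_mul, hom_cut]
      simp only [elt, tgt, exc, Letter.shift] at h ⊢
      rw [map_inv, hom_hElt, ← mul_assoc, ← mul_assoc,
        ← (zElt_zpow_commute s (hElt m j)⁻¹).eq, mul_assoc (zElt n k m ^ s), zpow_add, zpow_neg_one,
        mul_assoc (zElt n k m ^ s) (zElt n k m)⁻¹]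
      congr 2
      rw [inv_mul_eq_iff_eq_mul, ← mul_assoc, ← (zElt_commute (hElt m j)).inv_left.eq, mul_assoc, h,
        inv_mul_cancel_left]
    · refine .inr (Δ.eq_cut_of_hom hk hm (Δ.cuspIndex_lt s (exc (m := m) (.inr (j, true)))) ?_)
      have h := hElt_mul_cutElt_upper (m := m) j
      rw [map_mul, hom_cut]
      simp only [elt, tgt, exc, Letter.shift] at h ⊢
      rw [hom_hElt, add_zero, ← mul_assoc, ← mul_assoc,
        ← (zElt_zpow_commute s (hElt m j)).eq, mul_assoc (zElt n k m ^ s), h]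

end Cover

end ExtGroup

/-! ### Rigidity and isolation -/

namespace LeftOrder

variable {Γ : Type*} [Group Γ]

open Classical in
/-- A left order as a linear order. -/
noncomputable abbrev toLinearOrder (L : LeftOrder Γ) : LinearOrder Γ :=
  have := L.strictTotal
  linearOrderOfSTO L.lt

theorem toLinearOrder_lt (L : LeftOrder Γ) {a b : Γ} : L.toLinearOrder.lt a b ↔ L.lt a b := Iff.rfl

theorem toLinearOrder_le (L : LeftOrder Γ) {a b : Γ} : L.toLinearOrder.le a b ↔ L.le a b := by
  change a = b ∨ L.lt a b ↔ L.lt a b ∨ a = b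
  exact or_comm

end LeftOrder

namespace ExtGroup

open Letter

variable {n k : ℕ} {m : Fin k → ℕ}

namespace Cover

variable (Δ : Cover n m)

/-- The inequalities that characterize the left order of a covering. -/
structure Rigid (L : LeftOrder (ExtGroup n k m)) : Prop where
  rigidAt : ∀ s, Δ.RigidAt L s
  gap : L.lt (Δ.cut (-1) (k + 4 * n)) 1

/-- Left invariance spreads the inequalities from the cuts to arbitrary elements, so the group
ordered by `L` plays the same game as the line. -/
theorem Rigid.pingPong {L : LeftOrder (ExtGroup n k m)} (h : Δ.Rigid L) :
    letI := L.toLinearOrder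
    PingPong (k + 4 * n) (Letter.tgt (n := n) (m := m)) Letter.exc (Letter.shift Δ.δ) Δ.cut
      (fun a y => a.elt * y) := by
  let := L.toLinearOrder
  exact
    { tgt_lt := Letter.tgt_lt
      exc_lt := Letter.exc_lt
      mono := fun s q hq => L.toLinearOrder_le.2 ((h.rigidAt s).mono ⟨q, hq⟩)
      wrap := fun s => L.toLinearOrder_le.2 (h.rigidAt s).wrap
      lower := fun a s y hy =>
        lt_of_le_of_lt (L.toLinearOrder_le.2 ((h.rigidAt s).lower a)) (L.mul_left _ _ _ hy)
      upper := fun a s y hy =>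
        le_trans (L.toLinearOrder_le.2 (le_mul_left (L.toLinearOrder_le.1 hy) _))
          (L.toLinearOrder_le.2 ((h.rigidAt s).upper a)) }

theorem foldr_elt_mul (l : List (Letter n m)) (y : ExtGroup n k m) :
    l.foldr (fun a y => a.elt * y) y = wordElt l * y := by
  induction l with
  | nil => simp
  | cons a l ih => rw [List.foldr_cons, ih, wordElt_cons, mul_assoc]

theorem zpow_eq_cut (hk : 1 ≤ k) (hm : ∀ i, 2 ≤ m i) (s : ℤ) :
    zElt n k m ^ s = Δ.cut (Δ.D * s) 0 := by
  rw [← zero_add ((Δ.D : ℤ) * s), Δ.cut_add_mul hk hm, Δ.cut_zero_zero hk hm, mul_one]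

/-- The sign of a reduced word in the left order of a covering. -/
def WordPos (l : List (Letter n m)) (s : ℤ) : Prop :=
  (l = [] ∧ 0 < s) ∨
    (l ≠ [] ∧ 0 ≤ pingPongLevel Letter.tgt Letter.exc (Letter.shift Δ.δ) l 0 + Δ.D * s)

/-- The inequalities determine the sign of reduced words; moreover there is a largest negative
element. -/
theorem Rigid.sign (hk : 1 ≤ k) (hm : ∀ i, 2 ≤ m i) {L : LeftOrder (ExtGroup n k m)}
    (h : Δ.Rigid L) (l : List (Letter n m)) (hl : Reduced l) (s : ℤ) :
    (Δ.WordPos l s → L.lt 1 (wordElt l * zElt n k m ^ s)) ∧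
      (¬ Δ.WordPos l s → wordElt l * zElt n k m ^ s = 1 ∨
        L.le (wordElt l * zElt n k m ^ s) (Δ.cut (-1) (k + 4 * n))) := by
  let := L.toLinearOrder
  have P := h.pingPong
  have hD := Δ.pos
  have hone := Δ.cut_zero_zero hk hm
  rcases l with - | ⟨a, l⟩
  · simp only [WordPos, ne_eq, not_true_eq_false, false_and, or_false, true_and, wordElt_nil,
      one_mul, not_lt]
    have hne : ∀ s : ℤ, s ≠ 0 → zElt n k m ^ s ≠ 1 := fun s hs h => hs
      (zElt_zpow_injective hk hm (by simpa using h))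
    refine ⟨fun hs => ?_, fun hs => ?_⟩
    · refine L.toLinearOrder_lt.1 (lt_of_le_of_ne ?_ (hne s hs.ne').symm)
      rw [Δ.zpow_eq_cut hk hm, ← hone]
      exact P.mono_zero (by positivity)
    · rcases hs.lt_or_eq with hs | rfl
      · refine .inr (L.toLinearOrder_le.1 ?_)
        rw [Δ.zpow_eq_cut hk hm]
        exact (P.mono_zero (show Δ.D * s ≤ -1 by nlinarith)).trans
          (P.mono' (-1) (Nat.zero_le _) le_rfl)
      · exact .inl (zpow_zero _)
  -- The game starts at `1 = cut 0 0`. The strict inequality `gap` puts `1` beyond all blocks of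
  -- sheet `-1`, so every letter may come first.
  · obtain ⟨h1, h2⟩ := P.run a l 0 1 hl
      (lt_of_le_of_lt (P.mono' (0 - 1) (Letter.exc_lt _) le_rfl) h.gap)
      (by rw [← hone]; exact P.mono' 0 (Nat.zero_le _) (Letter.exc_lt _).le)
    rw [foldr_elt_mul, mul_one] at h1 h2
    set N := pingPongLevel Letter.tgt Letter.exc (Letter.shift Δ.δ) (a :: l) 0 with hN
    have h1' := L.mul_left (zElt n k m ^ s) _ _ h1
    have h2' := le_mul_left (L.toLinearOrder_le.1 h2) (zElt n k m ^ s)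
    rw [← Δ.cut_add_mul hk hm, (zElt_zpow_commute s _).eq] at h1' h2'
    simp only [WordPos, reduceCtorEq, false_and, false_or, ne_eq, not_false_eq_true, true_and,
      not_le]
    rw [← hN]
    refine ⟨fun hs => ?_, fun hs => .inr ?_⟩
    · refine L.toLinearOrder_lt.1 (lt_of_le_of_lt ?_ (L.toLinearOrder_lt.2 h1'))
      rw [← hone]
      exact (P.mono_zero hs).trans (P.mono' _ (Nat.zero_le _) (Letter.tgt_lt a).le)
    · refine L.toLinearOrder_le.1 (le_trans (L.toLinearOrder_le.2 h2') ?_)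
      -- A negative sheet is at most `-1`, so the product is bounded by the end of sheet `-1`,
      -- uniformly in the word.
      rcases (show N + Δ.D * s < -1 ∨ N + Δ.D * s = -1 by omega) with hs | hs
      · exact P.mono_lt (Letter.tgt_lt a) le_rfl hs
      · rw [hs]
        exact P.mono' _ (Letter.tgt_lt a) le_rfl

theorem Rigid.lt_iff (hk : 1 ≤ k) (hm : ∀ i, 2 ≤ m i) {L : LeftOrder (ExtGroup n k m)}
    (h : Δ.Rigid L) (l : List (Letter n m)) (hl : Reduced l) (s : ℤ) :
    L.lt 1 (wordElt l * zElt n k m ^ s) ↔ Δ.WordPos l s := by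
  let := L.toLinearOrder
  refine ⟨fun hlt => ?_, (h.sign Δ hk hm l hl s).1⟩
  by_contra hs
  rcases (h.sign Δ hk hm l hl s).2 hs with h1 | h1
  · rw [h1] at hlt
    exact L.strictTotal.irrefl 1 hlt
  · have h2 : (1 : ExtGroup n k m) < 1 := lt_trans (b := wordElt l * zElt n k m ^ s) hlt
      (lt_of_le_of_lt (L.toLinearOrder_le.2 h1) h.gap)
    exact lt_irrefl _ h2

theorem Rigid.eq (hk : 1 ≤ k) (hm : ∀ i, 2 ≤ m i) {L L' : LeftOrder (ExtGroup n k m)}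
    (h : Δ.Rigid L) (h' : Δ.Rigid L') : L = L' := by
  refine LeftOrder.ext_one_lt fun g => ?_
  obtain ⟨l, s, hl, rfl⟩ := exists_reduced hm g
  rw [h.lt_iff Δ hk hm l hl s, h'.lt_iff Δ hk hm l hl s]

theorem order_cut_lt_one (hk : 1 ≤ k) (hm : ∀ i, 2 ≤ m i) (hK : 2 ≤ k + 4 * n) :
    (Δ.order hk hm).lt (Δ.cut (-1) (k + 4 * n)) 1 := by
  rw [order_lt, Δ.hom_cut_neg_one hk hm, map_one, move_one]
  have h1 := (move_cuspElt_pow_mem hk hm hK Δ.D).2 Δ.pos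
  have h2 := cutPt_lt_one (n := n) (k := k) le_rfl
  linarith

theorem rigid_order (hk : 1 ≤ k) (hm : ∀ i, 2 ≤ m i) (hK : 2 ≤ k + 4 * n) :
    Δ.Rigid (Δ.order hk hm) :=
  ⟨Δ.rigidAt_order hk hm hK, Δ.order_cut_lt_one hk hm hK⟩

theorem isIsolated_order (hk : 1 ≤ k) (hm : ∀ i, 2 ≤ m i) (hK : 2 ≤ k + 4 * n) :
    (Δ.order hk hm).IsIsolated := by
  have hD : (0 : ℤ) < Δ.D := by exact_mod_cast Δ.pos
  -- One residue `s` for each class modulo `D` is enough, so the singleton is a finite intersection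
  -- of open sets.
  have : ({Δ.order hk hm} : Set (LeftOrder (ExtGroup n k m))) =
      {L | L.lt (Δ.cut (-1) (k + 4 * n)) 1} ∩ ⋂ s : Fin Δ.D, {L | Δ.RigidAt L (s : ℕ)} := by
    ext L
    simp only [Set.mem_singleton_iff, Set.mem_inter_iff, Set.mem_iInter, Set.mem_ofPred_eq]
    constructor
    · rintro rfl
      exact ⟨Δ.order_cut_lt_one hk hm hK, fun s => Δ.rigidAt_order hk hm hK _⟩
    · rintro ⟨h1, h2⟩
      refine Rigid.eq Δ hk hm ⟨fun s => ?_, h1⟩ (Δ.rigid_order hk hm hK)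
      have h3 := Int.emod_nonneg s hD.ne'
      have h4 := Int.emod_lt_of_pos s hD
      have h5 := (h2 ⟨(s % Δ.D).toNat, by omega⟩).add_mul Δ hk hm (s / Δ.D)
      rwa [Int.toNat_of_nonneg h3, Int.emod_add_mul_ediv] at h5
  rw [LeftOrder.IsIsolated, this]
  exact (LeftOrder.isOpen_setOf_lt _ _).inter
    (isOpen_iInter_of_finite fun s => Δ.isOpen_setOf_rigidAt _)

/-- The largest negative element. -/
theorem le_cut_of_lt_one (hk : 1 ≤ k) (hm : ∀ i, 2 ≤ m i) (hK : 2 ≤ k + 4 * n)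
    {g : ExtGroup n k m} (hg : (Δ.order hk hm).lt g 1) :
    (Δ.order hk hm).le g (Δ.cut (-1) (k + 4 * n)) := by
  have h := Δ.rigid_order hk hm hK
  obtain ⟨l, s, hl, rfl⟩ := exists_reduced hm g
  have hs : ¬ Δ.WordPos l s := fun hs =>
    (Δ.order hk hm).strictTotal.irrefl 1
      ((Δ.order hk hm).strictTotal.trans _ _ _ ((h.sign Δ hk hm l hl s).1 hs) hg)
  rcases (h.sign Δ hk hm l hl s).2 hs with h1 | h1
  · rw [h1] at hg
    exact absurd hg ((Δ.order hk hm).strictTotal.irrefl 1)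
  · exact h1

end Cover

end ExtGroup

/-! ### The center and translation numbers -/

namespace ExtGroup

open Letter

variable {n k : ℕ} {m : Fin k → ℕ}

section center

variable (hk : 1 ≤ k) (hm : ∀ i, 2 ≤ m i)

/-- The image of `0` lies in a block with index `q`. -/
def MovesTo (g : ExtGroup n k m) (q : ℕ) : Prop :=
  ∃ N : ℤ, cutPt n k q + N < move hk hm g 0 ∧ move hk hm g 0 ≤ cutPt n k (q + 1) + N

theorem MovesTo.unique {g : ExtGroup n k m} {p q : ℕ} (hp : p < k + 4 * n) (hq : q < k + 4 * n)
    (h : MovesTo hk hm g p) (h' : MovesTo hk hm g q) : p = q := by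
  obtain ⟨N, h1, h2⟩ := h
  obtain ⟨N', h1', h2'⟩ := h'
  have a1 := cutPt_nonneg (n := n) (k := k) p
  have a2 := cutPt_nonneg (n := n) (k := k) q
  have a3 := cutPt_lt_one (n := n) (k := k) (q := p + 1) hp
  have a4 := cutPt_lt_one (n := n) (k := k) (q := q + 1) hq
  obtain rfl : N = N' := by
    have b1 : (N : ℝ) < (N' + 1 : ℤ) := by push_cast; linarith
    have b2 : (N' : ℝ) < (N + 1 : ℤ) := by push_cast; linarith
    rw [Int.cast_lt] at b1 b2
    omega
  have c1 := (cutPt_strictMono (n := n) (k := k)).lt_iff_lt.1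
    (show cutPt n k p < cutPt n k (q + 1) by linarith)
  have c2 := (cutPt_strictMono (n := n) (k := k)).lt_iff_lt.1
    (show cutPt n k q < cutPt n k (p + 1) by linarith)
  omega

theorem movesTo_wordElt {a : Letter n m} {l : List (Letter n m)} (hl : Reduced (a :: l)) (s : ℤ) :
    MovesTo hk hm (wordElt (a :: l) * zElt n k m ^ s) a.tgt := by
  obtain ⟨N, h1, h2⟩ := move_wordElt_zero_mem hk hm a l hl
  refine ⟨N + s, ?_⟩
  rw [move_mul_zpow]
  push_cast
  exact ⟨by linarith, by linarith⟩

/-- Reduced words with the same product start in the same block. -/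
theorem tgt_eq_of_wordElt_eq (hk : 1 ≤ k) (hm : ∀ i, 2 ≤ m i) {a b : Letter n m}
    {l l' : List (Letter n m)} (hl : Reduced (a :: l)) (hl' : Reduced (b :: l')) {s s' : ℤ}
    (h : wordElt (a :: l) * zElt n k m ^ s = wordElt (b :: l') * zElt n k m ^ s') :
    a.tgt = b.tgt := by
  refine MovesTo.unique hk hm (Letter.tgt_lt a) (Letter.tgt_lt b) (movesTo_wordElt hk hm hl s) ?_
  rw [h]
  exact movesTo_wordElt hk hm hl' s'

theorem reduced_append_singleton {a b : Letter n m} {l : List (Letter n m)} (hl : Reduced (a :: l))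
    (h : ((a :: l).getLast (List.cons_ne_nil a l)).exc ≠ b.tgt) : Reduced (a :: (l ++ [b])) := by
  rw [← List.cons_append, Reduced, List.isChain_append]
  refine ⟨hl, List.isChain_singleton b, fun x hx y hy => ?_⟩
  rw [List.getLast?_eq_getLast_of_ne_nil (List.cons_ne_nil a l), Option.mem_some_iff] at hx
  rw [List.head?_cons, Option.mem_some_iff] at hy
  subst hx hy
  exact h

/-- The center is generated by `z`. -/
theorem exists_zpow_of_central (hk : 1 ≤ k) (hm : ∀ i, 2 ≤ m i) (hK : 2 ≤ k + 4 * n)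
    {g : ExtGroup n k m} (hg : ∀ h, g * h = h * g) : ∃ s : ℤ, g = zElt n k m ^ s := by
  obtain ⟨x, l, s, hl, hx, hc⟩ := exists_conj_cyclicallyReduced hm g
  -- A central element is its own conjugate, so `g` itself is cyclically reduced up to a power of
  -- `z`. If the word is nonempty, commutation yields two reduced words for one element that start
  -- in different blocks.
  rw [← hg, mul_inv_cancel_right] at hx
  have hcomm : ∀ b : ExtGroup n k m,
      b * wordElt l * zElt n k m ^ s = wordElt l * b * zElt n k m ^ s := by
    intro b
    have := hg b
    rw [hx, mul_assoc, (zElt_zpow_commute s b).eq] at this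
    rw [mul_assoc b, ← this, ← mul_assoc]
  have hm0 := hm ⟨0, hk⟩
  rcases hc with rfl | ⟨i, r, rfl⟩ | ⟨a, l, rfl, ha⟩
  · exact ⟨s, by simpa using hx⟩
  · exfalso
    obtain ⟨b, hb, hb'⟩ : ∃ b : Letter n m, b.tgt ≠ i ∧ b.exc ≠ i := by
      by_cases hi : (i : ℕ) = 0
      · by_cases hk2 : 2 ≤ k
        · have := hm ⟨1, hk2⟩
          refine ⟨.inl ⟨⟨1, hk2⟩, ⟨0, by omega⟩⟩, ?_, ?_⟩ <;> simp only [tgt, exc] <;> omega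
        · refine ⟨.inr (⟨0, by omega⟩, true), ?_, ?_⟩ <;> simp only [tgt, exc] <;> omega
      · refine ⟨.inl ⟨⟨0, hk⟩, ⟨0, by omega⟩⟩, ?_, ?_⟩ <;> simp only [tgt, exc] <;> omega
    have h1 : Reduced [b, .inl ⟨i, r⟩] :=
      List.isChain_cons_cons.2 ⟨hb', List.isChain_singleton _⟩
    have h2 : Reduced [.inl ⟨i, r⟩, b] :=
      List.isChain_cons_cons.2 ⟨hb.symm, List.isChain_singleton _⟩
    refine hb (tgt_eq_of_wordElt_eq hk hm h1 h2 (s := s) (s' := s) ?_)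
    simpa [mul_assoc] using hcomm b.elt
  · exfalso
    rcases l.eq_nil_or_concat with rfl | ⟨mid, c, rfl⟩
    · rw [List.getLast_singleton] at ha
      set b : Letter n m := .inl ⟨⟨0, hk⟩, ⟨0, by omega⟩⟩
      have ha0 : a.tgt ≠ 0 := fun h => ha (exc_eq_tgt_of_tgt_lt (by omega))
      have ha1 : a.exc ≠ 0 := fun h => ha (exc_eq_tgt_of_exc_lt (by omega))
      have h1 : Reduced [b, a] :=
        List.isChain_cons_cons.2 ⟨ha0.symm, List.isChain_singleton _⟩
      have h2 : Reduced [a, b] :=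
        List.isChain_cons_cons.2 ⟨ha1, List.isChain_singleton _⟩
      refine ha0 (tgt_eq_of_wordElt_eq hk hm h1 h2 (s := s) (s' := s) ?_).symm
      simpa [mul_assoc] using hcomm b.elt
    · rw [List.concat_eq_append] at *
      have hlast : (a :: (mid ++ [c])).getLast (List.cons_ne_nil _ _) = c := by simp
      rw [hlast] at ha
      -- The letter `b` of block `0` can be put on either side unless the word ends or starts in
      -- that block. In those cases commuting with the end letter itself, which rotates the word,
      -- gives the contradiction.
      by_cases hc0 : c.exc = 0
      · have h1 : Reduced (c :: a :: mid) := by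
          refine List.isChain_cons_cons.2 ⟨ha, ?_⟩
          rw [← List.cons_append] at hl
          exact hl.left_of_append
        have h2 := tgt_eq_of_wordElt_eq hk hm h1 hl (s := s) (s' := s) (by
          have := hg c.elt
          rw [hx] at this
          simp only [wordElt_cons, wordElt_append, wordElt_nil, mul_one] at this ⊢
          have h3 : c.elt * (a.elt * wordElt mid) * zElt n k m ^ s * c.elt =
              a.elt * (wordElt mid * c.elt) * zElt n k m ^ s * c.elt := by
            rw [this, mul_assoc _ (zElt n k m ^ s), (zElt_zpow_commute s _).eq]
            simp only [mul_assoc]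
          exact mul_right_cancel h3)
        rw [← exc_eq_tgt_of_exc_lt (by omega)] at h2
        exact ha h2
      · by_cases ha0 : a.tgt = 0
        · have hexc := exc_eq_tgt_of_tgt_lt (a := a) (by omega)
          obtain ⟨d, l', hd⟩ : ∃ d l', mid ++ [c] = d :: l' := by
            cases mid with
            | nil => exact ⟨c, [], rfl⟩
            | cons d mid => exact ⟨d, mid ++ [c], rfl⟩
          have h1 : Reduced (d :: (l' ++ [a])) := by
            refine reduced_append_singleton (hd ▸ hl.tail) ?_
            have : (d :: l').getLast (List.cons_ne_nil d l') = c := by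
              simp only [← hd, List.getLast_append_singleton]
            rwa [this]
          have h2 : a.tgt = d.tgt := tgt_eq_of_wordElt_eq hk hm hl h1 (s := s) (s' := s) (by
            have h3 := hg a.elt
            rw [hx] at h3
            rw [hd] at h3 ⊢
            rw [← List.cons_append, wordElt_append, wordElt_cons a [], wordElt_nil, mul_one]
            rw [wordElt_cons a] at h3 ⊢
            refine mul_left_cancel (a := a.elt) ?_
            rw [← h3]
            rw [mul_assoc _ (zElt n k m ^ s), (zElt_zpow_commute s _).eq]
            simp only [mul_assoc])
          rw [hd] at hl
          exact (List.isChain_cons_cons.1 hl).1 (hexc.trans h2)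
        · set b : Letter n m := .inl ⟨⟨0, hk⟩, ⟨0, by omega⟩⟩
          have h1 : Reduced (b :: a :: (mid ++ [c])) :=
            List.isChain_cons_cons.2 ⟨Ne.symm ha0, hl⟩
          have h2 : Reduced (a :: (mid ++ [c] ++ [b])) :=
            reduced_append_singleton hl (by rw [hlast]; exact hc0)
          refine ha0 (tgt_eq_of_wordElt_eq hk hm h1 h2 (s := s) (s' := s) ?_).symm
          simpa [mul_assoc] using hcomm b.elt

end center

section translationNumber

open CircleDeg1Lift

variable (hk : 1 ≤ k) (hm : ∀ i, 2 ≤ m i)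

/-- The translation number of an element. -/
noncomputable def transNum (g : ExtGroup n k m) : ℝ :=
  translationNumber (lineHom hk hm g : CircleDeg1Lift)

theorem transNum_conj (x g : ExtGroup n k m) :
    transNum hk hm (x * g * x⁻¹) = transNum hk hm g := by
  rw [transNum, map_mul, map_mul, map_inv, Units.val_mul, Units.val_mul, translationNumber_conj_eq,
    transNum]

theorem transNum_pow (g : ExtGroup n k m) (r : ℕ) :
    transNum hk hm (g ^ r) = r * transNum hk hm g := by
  rw [transNum, map_pow, Units.val_pow_eq_pow_val, translationNumber_pow, transNum]

theorem transNum_zpow (s : ℤ) : transNum hk hm (zElt n k m ^ s) = s :=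
  translationNumber_of_eq_add_int _ (x := 0) (move_zpow hk hm s 0)

theorem transNum_mul_zpow (g : ExtGroup n k m) (s : ℤ) :
    transNum hk hm (g * zElt n k m ^ s) = transNum hk hm g + s := by
  have hcomm : Commute (lineHom hk hm g : CircleDeg1Lift) (lineHom hk hm (zElt n k m ^ s)) := by
    have h := (zElt_zpow_commute s g).symm.map (lineHom hk hm)
    rw [Commute, SemiconjBy, ← Units.val_mul, h.eq, Units.val_mul]
  rw [transNum, map_mul, Units.val_mul, translationNumber_mul_of_commute hcomm]
  exact congrArg _ (transNum_zpow hk hm s)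

/-- The orbit of `0` under the positive powers stays in a bounded interval. -/
theorem transNum_cuspElt (hK : 2 ≤ k + 4 * n) : transNum hk hm (cuspElt n m) = 0 := by
  apply le_antisymm
  · have h := (move_cuspElt_pow_mem hk hm hK 1).1.2
    rw [cutPt_zero, pow_one] at h
    have := translationNumber_le_of_le_add_int (lineHom hk hm (cuspElt n m) : CircleDeg1Lift)
      (x := 0) (m := 0) (by rw [Int.cast_zero, add_zero]; exact h)
    rwa [Int.cast_zero] at this
  · by_contra! hneg
    -- A negative translation number would bring the `r`-th power below `-2`, while it is within `1`
    -- of the displacement of `0`, which exceeds `-1`.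
    obtain ⟨r, hr⟩ := exists_nat_gt (2 / -transNum hk hm (cuspElt n m))
    rw [div_lt_iff₀ (by linarith)] at hr
    have h1 := dist_map_zero_translationNumber_le
      (lineHom hk hm (cuspElt n m ^ r) : CircleDeg1Lift)
    have h2 : -1 < lineHom hk hm (cuspElt n m ^ r) 0 := by
      have := (move_cuspElt_pow_mem hk hm hK r).1.1
      have h3 := cutPt_one_pos (n := n) (k := k)
      rw [zero_add] at this
      change -1 < move hk hm (cuspElt n m ^ r) 0
      linarith
    have h3 := transNum_pow hk hm (cuspElt n m) r
    rw [transNum] at h3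
    rw [h3, Real.dist_eq, abs_le] at h1
    linarith

/-- A cyclically reduced word maps its first target block into an integer translate of that block,
so both bounds on the translation number are the same integer. -/
theorem transNum_cyclicallyReduced (a : Letter n m) (l : List (Letter n m))
    (hl : Reduced (a :: l))
    (ha : ((a :: l).getLast (List.cons_ne_nil a l)).exc ≠ a.tgt) :
    ∃ N : ℤ, transNum hk hm (wordElt (a :: l)) = N := by
  set c := (a :: l).getLast (List.cons_ne_nil a l) with hc
  have hcK := Letter.exc_lt c
  have haK := Letter.tgt_lt a
  obtain ⟨N, hN⟩ : ∃ N : ℤ, ∀ y, cutPt n k a.tgt < y → y ≤ cutPt n k (a.tgt + 1) →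
      cutPt n k a.tgt + N < move hk hm (wordElt (a :: l)) y ∧
        move hk hm (wordElt (a :: l)) y ≤ cutPt n k (a.tgt + 1) + N := by
    have mono := (cutPt_strictMono (n := n) (k := k)).monotone
    rcases lt_or_gt_of_ne ha with h | h
    · obtain ⟨N, hN⟩ := move_wordElt_mem hk hm a l hl 1
      refine ⟨N, fun y hy hy' => hN y ?_ ?_⟩
      · have := mono (show c.exc + 1 ≤ a.tgt from h)
        rw [← hc]
        push_cast
        linarith
      · have h1 := cutPt_lt_one (n := n) (k := k) (q := a.tgt + 1) haK
        have h2 := cutPt_nonneg (n := n) (k := k) c.exc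
        rw [← hc]
        push_cast
        linarith
    · obtain ⟨N, hN⟩ := move_wordElt_mem hk hm a l hl 0
      refine ⟨N, fun y hy hy' => hN y ?_ ?_⟩
      · have h1 := cutPt_lt_one (n := n) (k := k) (q := c.exc + 1) hcK
        have h2 := cutPt_nonneg (n := n) (k := k) a.tgt
        rw [← hc]
        push_cast
        linarith
      · have := mono (show a.tgt + 1 ≤ c.exc from h)
        rw [← hc]
        push_cast
        linarith
  have hlt : cutPt n k a.tgt < cutPt n k (a.tgt + 1) := cutPt_strictMono a.tgt.lt_succ_self
  refine ⟨N, le_antisymm ?_ ?_⟩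
  · exact translationNumber_le_of_le_add_int _ (x := cutPt n k (a.tgt + 1))
      (hN _ hlt le_rfl).2
  · refine le_translationNumber_of_add_int_le _ (x := cutPt n k a.tgt) ?_
    change _ ≤ move hk hm (wordElt (a :: l)) (cutPt n k a.tgt)
    -- The half-open block omits its left end. If that end were mapped too low, the preimage `w` of
    -- the translated end would lie inside the block, where the strict bound applies.
    by_contra! h
    set w := move hk hm (wordElt (a :: l))⁻¹ (cutPt n k a.tgt + N) with hw
    have hw' : move hk hm (wordElt (a :: l)) w = cutPt n k a.tgt + N := by
      rw [hw, ← move_mul, mul_inv_cancel, move_one]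
    rw [← hw'] at h
    have h1 := (move_strictMono hk hm _).lt_iff_lt.1 h
    have h2 : w < cutPt n k (a.tgt + 1) := by
      refine (move_strictMono hk hm (wordElt (a :: l))).lt_iff_lt.1 ?_
      rw [hw']
      exact (hN _ hlt le_rfl).1
    have h3 := (hN w h1 h2.le).1
    rw [hw'] at h3
    exact lt_irrefl _ h3

/-- Translation numbers are rational with bounded denominators. -/
theorem exists_int_eq_mul_transNum (g : ExtGroup n k m) :
    ∃ b : ℤ, ((∏ i, m i : ℕ) : ℝ) * transNum hk hm g = b := by
  obtain ⟨x, l, s, hl, hx, hc⟩ := exists_conj_cyclicallyReduced hm g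
  rw [← transNum_conj hk hm x, hx]
  rcases hc with rfl | ⟨i, r, rfl⟩ | ⟨a, l, rfl, ha⟩
  · refine ⟨(∏ i, m i : ℕ) * s, ?_⟩
    rw [wordElt_nil, one_mul, transNum_zpow]
    push_cast
    ring
  · have hmi : (m i : ℝ) * transNum hk hm (wordElt [.inl ⟨i, r⟩] : ExtGroup n k m) =
        ((r : ℕ) + 1 : ℕ) := by
      rw [← transNum_pow, wordElt_cons, wordElt_nil, mul_one, elt, ← pow_mul, mul_comm, pow_mul,
        eElt_pow, ← zpow_natCast, transNum_zpow]
      simp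
    refine ⟨(∏ i' ∈ Finset.univ.erase i, m i' : ℕ) * ((r : ℕ) + 1 : ℕ) + (∏ i, m i : ℕ) * s, ?_⟩
    rw [transNum_mul_zpow, mul_add, ← Finset.prod_erase_mul _ _ (Finset.mem_univ i), Nat.cast_mul,
      mul_assoc, hmi]
    push_cast
    ring
  · obtain ⟨N, hN⟩ := transNum_cyclicallyReduced hk hm a l hl ha
    refine ⟨(∏ i, m i : ℕ) * (N + s), ?_⟩
    rw [transNum_mul_zpow, hN]
    push_cast
    ring

end translationNumber

/-! ### Distinguishing the orders up to automorphism -/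

namespace Cover

/-- The degree of the covering is an invariant of its left order up to automorphisms. -/
theorem dvd_of_order_eq_autImage (hk : 1 ≤ k) (hm : ∀ i, 2 ≤ m i) (hK : 2 ≤ k + 4 * n)
    (Δ Δ' : Cover n m) (φ : ExtGroup n k m ≃* ExtGroup n k m)
    (h : Δ.order hk hm = (Δ'.order hk hm).autImage φ) : Δ.D ∣ Δ'.D := by
  set ν := Δ.cut (-1) (k + 4 * n) with hν
  set ν' := Δ'.cut (-1) (k + 4 * n) with hν'
  have hlt : ∀ a b, (Δ.order hk hm).lt a b ↔ (Δ'.order hk hm).lt (φ a) (φ b) := by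
    intro a b
    rw [h]
    rfl
  -- An order isomorphism fixing `1` matches the largest negative elements.
  have hφν : φ ν = ν' := by
    have h1 : (Δ'.order hk hm).le (φ ν) ν' := by
      refine Δ'.le_cut_of_lt_one hk hm hK ?_
      rw [← map_one φ, ← hlt]
      exact Δ.order_cut_lt_one hk hm hK
    have h2 : (Δ.order hk hm).le (φ.symm ν') ν := by
      refine Δ.le_cut_of_lt_one hk hm hK ?_
      rw [hlt, φ.apply_symm_apply, map_one]
      exact Δ'.order_cut_lt_one hk hm hK
    rcases h1 with h1 | h1
    · rcases h2 with h2 | h2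
      · rw [hlt, φ.apply_symm_apply] at h2
        exact absurd ((Δ'.order hk hm).strictTotal.trans _ _ _ h1 h2)
          ((Δ'.order hk hm).strictTotal.irrefl _)
      · rw [← h2, φ.apply_symm_apply]
    · exact h1
  obtain ⟨s, hs⟩ := Δ.hom_eq_mul ν
  obtain ⟨s', hs'⟩ := Δ'.hom_eq_mul ν'
  rw [hν, Δ.hom_cut_neg_one hk hm, ← hν] at hs
  rw [hν', Δ'.hom_cut_neg_one hk hm, ← hν'] at hs'
  obtain ⟨ε, hε⟩ := exists_zpow_of_central (g := φ (zElt n k m)) hk hm hK (fun x => by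
    rw [← φ.apply_symm_apply x, ← map_mul, ← map_mul, (zElt_commute _).eq])
  -- Up to powers of `z`, `ν` is `cuspElt ^ D` and `ν'` is `cuspElt ^ D'`, and `φ` maps `z` into
  -- `⟨z⟩`.
  have hy : φ (cuspElt n m) ^ Δ.D = cuspElt n m ^ Δ'.D * zElt n k m ^ (ε * s - s') := by
    rw [← map_pow, hs, map_mul, map_zpow, hφν, hε, hs', ← zpow_mul, mul_assoc, ← zpow_add]
    congr 2
    ring
  obtain ⟨b, hb⟩ := exists_int_eq_mul_transNum hk hm (φ (cuspElt n m))
  have h1 := congrArg deg hy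
  rw [deg_pow, deg_mul, deg_pow, deg_zpow, deg_zElt] at h1
  have h2 := congrArg (transNum hk hm) hy
  rw [transNum_pow, transNum_mul_zpow, transNum_pow, transNum_cuspElt hk hm hK, mul_zero,
    zero_add] at h2
  -- Translation numbers ignore `cuspElt ^ D'` and show that the unknown power of `z` has degree
  -- divisible by `D`; the degree equation `h1` then leaves `D ∣ D' * deg cuspElt`.
  have h3 : (Δ.D : ℤ) * b = (∏ i, m i : ℕ) * (ε * s - s') := by
    have : ((Δ.D * b : ℤ) : ℝ) = ((∏ i, m i : ℕ) * (ε * s - s') : ℤ) := by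
      push_cast at h2 hb ⊢
      rw [← hb, ← h2]
      ring
    exact_mod_cast this
  have h4 : (Δ.D : ℤ) ∣ Δ'.D * deg (cuspElt n m) :=
    ⟨deg (φ (cuspElt n m)) - b, by linarith⟩
  exact_mod_cast Δ.coprime_cusp.dvd_of_dvd_mul_right h4

/-- Coverings of arbitrarily large degree. -/
noncomputable def ofNat (hpos : 0 < deg (cuspElt n m)) (t : ℕ) : Cover n m where
  -- Being `1` modulo the product of all moduli involved gives the congruences and both coprimality
  -- conditions at once.
  D := 1 + (∏ i, m i) * (deg (cuspElt n m)).toNat * t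
  δ i := deg (eElt n m i) * deg (cuspElt n m) * t
  pos := by omega
  eq_add i := by
    push_cast [Int.toNat_of_nonneg hpos.le]
    have := mul_deg_eElt (n := n) (m := m) i
    push_cast at this
    rw [← this]
    ring
  coprime_z := by
    refine ⟨1, -(deg (cuspElt n m) * t), ?_⟩
    rw [deg_zElt]
    push_cast [Int.toNat_of_nonneg hpos.le]
    ring
  coprime_cusp := by
    refine ⟨1, -((∏ i, m i : ℕ) * t), ?_⟩
    push_cast [Int.toNat_of_nonneg hpos.le]
    ring

end Cover

end ExtGroup

theorem theorem1p2 (n k : ℕ) (m : Fin k → ℕ) (hk : 1 ≤ k) (hm : ∀ i, 2 ≤ m i)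
    (h₁ : ¬ (n = 0 ∧ k = 1))
    (h₂ : ¬ (n = 0 ∧ k = 2 ∧ ∀ i, m i = 2)) :
    -- the group is a central extension of the free product by the infinite cyclic group `⟨z⟩`
    (¬ IsOfFinOrder (ExtGroup.zElt n k m) ∧
      Subgroup.zpowers (ExtGroup.zElt n k m) ≤ Subgroup.center (ExtGroup n k m) ∧
      ∃ π : ExtGroup n k m →* FreeProdCyclic n k m,
        Function.Surjective π ∧ π.ker = Subgroup.zpowers (ExtGroup.zElt n k m)) ∧
    -- a countably infinite family of isolated left orders, none an automorphic image of another
    ∃ L : ℕ → LeftOrder (ExtGroup n k m),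
      (∀ i, (L i).IsIsolated) ∧
      ∀ i j, i ≠ j → ∀ φ : ExtGroup n k m ≃* ExtGroup n k m, L i ≠ (L j).autImage φ := by
  have hK : 2 ≤ k + 4 * n := by omega
  have hpos := ExtGroup.deg_cuspElt_pos hk hm h₁ h₂
  refine ⟨⟨ExtGroup.not_isOfFinOrder_zElt hk hm, ExtGroup.zpowers_le_center,
    ExtGroup.toFreeProd n m, ExtGroup.toFreeProd_surjective hm, ExtGroup.toFreeProd_ker⟩,
    fun t => (ExtGroup.Cover.ofNat hpos t).order hk hm,
    fun t => ExtGroup.Cover.isIsolated_order _ hk hm hK, fun i j hij φ h => hij ?_⟩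
  dsimp only at h
  -- The relation is symmetric through `φ.symm`, so divisibility holds both ways and the degrees
  -- agree.
  have h' : (ExtGroup.Cover.ofNat hpos j).order hk hm =
      ((ExtGroup.Cover.ofNat hpos i).order hk hm).autImage φ.symm := by
    refine LeftOrder.ext_one_lt fun g => ?_
    rw [h]
    change _ ↔ ((ExtGroup.Cover.ofNat hpos j).order hk hm).lt (φ (φ.symm 1)) (φ (φ.symm g))
    rw [φ.apply_symm_apply, φ.apply_symm_apply]
  have hD : (ExtGroup.Cover.ofNat hpos i).D = (ExtGroup.Cover.ofNat hpos j).D :=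
    Nat.dvd_antisymm (ExtGroup.Cover.dvd_of_order_eq_autImage hk hm hK _ _ φ h)
      (ExtGroup.Cover.dvd_of_order_eq_autImage hk hm hK _ _ φ.symm h')
  have hM : 0 < ∏ i, m i := Finset.prod_pos fun i _ => by have := hm i; omega
  have hE : 0 < (ExtGroup.deg (ExtGroup.cuspElt n m)).toNat := by omega
  simp only [ExtGroup.Cover.ofNat] at hD
  exact Nat.eq_of_mul_eq_mul_left (Nat.mul_pos hM hE) (by omega)
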